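/- A permutation $\sigma$ of $\{1,\dots,n\}$ is a Baxter permutation if there are no indices $1\le i<j<k\le n$ with $\sigma(j+1)<\sigma(i)<\sigma(k)<\sigma(j)$ or $\sigma(j)<\sigma(k)<\sigma(i)<\sigma(j+1)$; it is alternating if $\sigma(1)<\sigma(2)>\sigma(3)<\sigma(4)>\cdots$; a Baxter permutation $\sigma$ is doubly alternating if both $\sigma$ and $\sigma^{-1}$ are alternating. Let $\mathcal B_n$ be the set of doubly alternating Baxter permutations of $\{1,\dots,n\}$, and for $1\le i,j\le 2m$ let $B(m,i,j)$ be the number of $\sigma\in\mathcal B_{2m}$ with $\sigma(i)=j$. Let $C_n$ be the $n$-th Catalan number, and for $r,s\ge 1$ let $p_{r,s}$ be the number of Dyck paths of length $2(r+s-1)$ that first revisit the horizontal axis by step $2s$ at the latest. (1) For all $r,s\ge 1$, $$p_{r,s}=\sum_{k=1}^{s} C_{r+s-(k+1)}\,C_{k-1}.$$ (2) Let $m,i,j$ be integers with $i\ge 1$ and $i\le j\le 2m-i$, and set $a=\lceil i/2\rceil$, $b=\lfloor j/2\rfloor$. If $j$ is odd, then $$B(m,i,j)=C_b\,C_{m-b-1}+\sum_{r=1}^{a-1}\sum_{s=1}^{a-r}p_{r,s}\,C_{b-r+1}\,C_{m-b-s-1},$$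 and if $j$ is even, then $$B(m,i,j)=\sum_{r=1}^{a-1}\sum_{s=1}^{a-r}p_{r,s}\,C_{b-r}\,C_{m-b-s}.$$ -/

import Mathlib

/-- A permutation `σ` of `{1, …, n}` (modelled on `Fin n`, so that position `k` and value `v`
correspond to the elements with underlying numbers `k - 1` and `v - 1`) is a *Baxter permutation*
if there are no indices `i < j < k` such that `σ (j+1) < σ i < σ k < σ j` or
`σ j < σ k < σ i < σ (j+1)`. Here `j'` is the index `j + 1`, which exists since `j < k`. -/
def IsBaxterPerm {n : ℕ} (σ : Equiv.Perm (Fin n)) : Prop :=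
  ¬ ∃ i j j' k : Fin n, i < j ∧ j < k ∧ (j' : ℕ) = (j : ℕ) + 1 ∧
    ((σ j' < σ i ∧ σ i < σ k ∧ σ k < σ j) ∨ (σ j < σ k ∧ σ k < σ i ∧ σ i < σ j'))

/-- A permutation is *alternating* if `σ(1) < σ(2) > σ(3) < σ(4) > …`. The position with
underlying number `k` is the `(k+1)`-st one, so ascents are at even `k` and descents at odd `k`. -/
def IsAlternatingPerm {n : ℕ} (σ : Equiv.Perm (Fin n)) : Prop :=
  ∀ k k' : Fin n, (k' : ℕ) = (k : ℕ) + 1 →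
    (Even (k : ℕ) → σ k < σ k') ∧ (Odd (k : ℕ) → σ k' < σ k)

/-- The set of doubly alternating Baxter permutations of length `n`. -/
def doublyAlternatingBaxter (n : ℕ) : Set (Equiv.Perm (Fin n)) :=
  {σ | IsBaxterPerm σ ∧ IsAlternatingPerm σ ∧ IsAlternatingPerm σ⁻¹}

/-- `B(m, i, j)`: the number of doubly alternating Baxter permutations `σ` of length `2m` with
`σ(i) = j`, where positions and values are numbered from `1` to `2m`. -/
noncomputable def dabCount (m i j : ℕ) : ℕ :=
  Set.ncard {σ : Equiv.Perm (Fin (2 * m)) | σ ∈ doublyAlternatingBaxter (2 * m) ∧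
    ∃ k : Fin (2 * m), (k : ℕ) + 1 = i ∧ (σ k : ℕ) + 1 = j}

/-- `p_{r,s}` (for `r, s ≥ 1`): the number of Dyck paths of length `2(r+s-1)` which first revisit
the horizontal axis by step `2s` at the latest. `DyckWord.firstReturn` is the index, counted from
`0`, of the step that ends at the first return, so that return happens at step
`firstReturn + 1`. -/
noncomputable def dyckFirstReturnCount (r s : ℕ) : ℕ :=
  Set.ncard {w : DyckWord | w.toList.length = 2 * (r + s - 1) ∧ w.firstReturn + 1 ≤ 2 * s}

/-!
The proof rests on a Catalan decomposition of doubly alternating Baxter permutations of even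
length: each nonempty one is uniquely of the form `(1 ⊕ τᶜ ⊕ 1) ⊖ ρ`, where `τ` and `ρ` are again
doubly alternating Baxter permutations of even length and `τᶜ` is the complement of `τ`
(`IsDAB.exists_decomposition`, `dabDecompositionEquiv`).

To find the decomposition, let `v` be the first value. An ascent of `σ` that ends above `v` crosses
an ascent `s, s + 1` of `σ⁻¹` with `s ≥ v`, and the Baxter condition makes the assignment of `s` to
the ascent injective. As ascents sit at even indices, at most half of the values `≥ v` stand at odd
positions; hence `σ` never rises from below `v` to above `v`, and the values `≥ v` fill an
initial segment of positions (`IsDAB.apply_zero_le_iff`). This splits off `ρ`. The same fact for the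
reverse-complement shows that a first block that starts with its minimum ends with its maximum.

The decomposition gives a recursion for the numbers `B(m, i, j)` (`dabNum_succ`). For each parity of
`j` it becomes a pair of linear equations for a power series in `z`, `x`, `y` and its image under
the exchange of `x` and `y`; the exponents `b`, `g` of `x`, `y` record `j` and `2m - j`, and that of
`z` records `i`. Let `c` be the Catalan series, `X = z² x c(z² x)` and `Y = z² y c(z² y)`. The
solution of the system is `1 / (1 - z) · c(x) c(y) · (1 + Y / (1 - X - Y))`, respectively
`1 / (1 - z) · c(x) c(y) · Y / (1 - X - Y)`, plus a series all of whose monomials `zⁱ xᵇ yᵍ` have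
`i` large compared with `2 b` or with `2 g` (`evenSeries_decomposition`, `oddSeries_decomposition`).
The remainder therefore does not contribute in the range `i ≤ j ≤ 2m - i`. The coefficients of
`Y / (1 - X - Y)` are the numbers `p_{r,s}` (`coeff_mono_mul_cat_mul_ballotSeries`), so that the
main part has the coefficients claimed in the theorem.
-/

/-! ### Dyck words by first return -/

/-- Cutting a nonempty Dyck word `p.nest + q` at its first return counts the words by the
semilength of `p`. -/
theorem dyckFirstReturnCount_eq_sum {r s : ℕ} (hr : 1 ≤ r) (hs : 1 ≤ s) :
    dyckFirstReturnCount r s =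
      ∑ k ∈ Finset.Icc 1 s, catalan (r + s - (k + 1)) * catalan (k - 1) := by
  let S : Set DyckWord := {w | w.toList.length = 2 * (r + s - 1) ∧ w.firstReturn + 1 ≤ 2 * s}
  let T := Σ k : Fin s, {p : DyckWord // p.semilength = k} ×
    {q : DyckWord // q.semilength = r + s - (k + 2)}
  have hfr : ∀ p q : DyckWord, (p.nest + q).firstReturn = 2 * p.semilength + 1 := fun p q ↦ by
    rw [DyckWord.firstReturn_add, if_neg DyckWord.nest_ne_zero, DyckWord.firstReturn_nest,
      ← DyckWord.two_mul_semilength_eq_length]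
  let f : T → S := fun x ↦ ⟨x.2.1.1.nest + x.2.2.1, by
    obtain ⟨k, ⟨p, hp⟩, ⟨q, hq⟩⟩ := x
    refine ⟨?_, ?_⟩
    · rw [← DyckWord.two_mul_semilength_eq_length, DyckWord.semilength_add,
        DyckWord.semilength_nest]
      dsimp only
      omega
    · rw [hfr]
      dsimp only
      omega⟩
  have hf : Function.Bijective f := by
    constructor
    · rintro ⟨k, ⟨p, hp⟩, ⟨q, hq⟩⟩ ⟨k', ⟨p', hp'⟩, ⟨q', hq'⟩⟩ h
      have h0 : p.nest + q = p'.nest + q' := congrArg Subtype.val h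
      have h1 : p = p' := by
        have := congrArg DyckWord.insidePart h0
        rwa [DyckWord.insidePart_add DyckWord.nest_ne_zero,
          DyckWord.insidePart_add DyckWord.nest_ne_zero, DyckWord.insidePart_nest,
          DyckWord.insidePart_nest] at this
      subst h1
      have h2 : q = q' := add_left_cancel h0
      subst h2
      have h3 : k = k' := Fin.ext (hp.symm.trans hp')
      subst h3
      rfl
    · rintro ⟨w, hw, hw'⟩
      have hl := w.two_mul_semilength_eq_length
      have hw0 : w ≠ 0 := by
        rintro rfl
        rw [DyckWord.semilength_zero] at hl
        omega
      have hd := DyckWord.nest_insidePart_add_outsidePart hw0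
      have hs1 := DyckWord.semilength_insidePart_add_semilength_outsidePart_add_one hw0
      rw [← hd, hfr] at hw'
      exact ⟨⟨⟨w.insidePart.semilength, by omega⟩, ⟨w.insidePart, rfl⟩,
        ⟨w.outsidePart, by dsimp only; omega⟩⟩, Subtype.ext hd⟩
  change Set.ncard S = _
  rw [← Nat.card_coe_set_eq, ← Nat.card_congr (Equiv.ofBijective f hf), Nat.card_sigma]
  rw [Finset.sum_fin_eq_sum_range]
  refine Finset.sum_bij' (fun k _ ↦ k + 1) (fun k _ ↦ k - 1) ?_ ?_ ?_ ?_ ?_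
  · intro k hk
    simp only [Finset.mem_range, Finset.mem_Icc] at hk ⊢
    omega
  · intro k hk
    simp only [Finset.mem_range, Finset.mem_Icc] at hk ⊢
    omega
  · intro k hk
    omega
  · intro k hk
    simp only [Finset.mem_Icc] at hk
    omega
  · intro k hk
    rw [dif_pos (Finset.mem_range.mp hk), Nat.card_prod, Nat.card_eq_fintype_card,
      Nat.card_eq_fintype_card, DyckWord.card_dyckWord_semilength_eq_catalan,
      DyckWord.card_dyckWord_semilength_eq_catalan, mul_comm]
    rfl

/-! ### The first value of a doubly alternating Baxter permutation -/

/-- `IsDAB n σ`: the permutation `σ` of `ℕ` fixes every `k ≥ n`, and its restriction to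
`{0, …, n - 1}` is a doubly alternating Baxter permutation. Working with permutations of `ℕ` avoids
casts between the types `Fin n` when permutations are cut and glued. -/
structure IsDAB (n : ℕ) (σ : Equiv.Perm ℕ) : Prop where
  fix : ∀ k, n ≤ k → σ k = k
  baxter : ∀ i j k, i < j → j < k → k < n →
    ¬ ((σ (j + 1) < σ i ∧ σ i < σ k ∧ σ k < σ j) ∨ (σ j < σ k ∧ σ k < σ i ∧ σ i < σ (j + 1)))
  alt : ∀ k, k + 1 < n → (Even k → σ k < σ (k + 1)) ∧ (Odd k → σ (k + 1) < σ k)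
  alt_symm : ∀ k, k + 1 < n →
    (Even k → σ.symm k < σ.symm (k + 1)) ∧ (Odd k → σ.symm (k + 1) < σ.symm k)

theorem Equiv.Perm.lt_iff_lt_of_fix {n : ℕ} {σ : Equiv.Perm ℕ} (h : ∀ k, n ≤ k → σ k = k) (k : ℕ) :
    σ k < n ↔ k < n := by
  constructor
  · intro hk
    by_contra hn
    rw [h k (not_lt.mp hn)] at hk
    exact hn hk
  · intro hk
    by_contra hn
    have := σ.injective (h _ (not_lt.mp hn))
    omega

theorem Equiv.Perm.symm_fix {n : ℕ} {σ : Equiv.Perm ℕ} (h : ∀ k, n ≤ k → σ k = k) (k : ℕ)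
    (hk : n ≤ k) : σ.symm k = k := by
  rw [Equiv.symm_apply_eq, h k hk]

theorem Equiv.Perm.symm_lt_iff_lt_of_fix {n : ℕ} {σ : Equiv.Perm ℕ} (h : ∀ k, n ≤ k → σ k = k)
    (k : ℕ) : σ.symm k < n ↔ k < n :=
  Equiv.Perm.lt_iff_lt_of_fix (σ := σ.symm) (Equiv.Perm.symm_fix h) k

theorem Nat.exists_lt_and_not_succ {p : ℕ → Prop} {a b : ℕ} (hab : a ≤ b) (ha : p a) (hb : ¬ p b) :
    ∃ t, a ≤ t ∧ t < b ∧ p t ∧ ¬ p (t + 1) := by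
  induction b, hab using Nat.le_induction with
  | base => exact absurd ha hb
  | succ b hab ih =>
    by_cases h : p b
    · exact ⟨b, hab, b.lt_succ_self, h, hb⟩
    · obtain ⟨t, h1, h2, h3⟩ := ih h
      exact ⟨t, h1, h2.trans b.lt_succ_self, h3⟩

namespace IsDAB

variable {n m : ℕ} {σ : Equiv.Perm ℕ}

theorem alt_even (h : IsDAB n σ) {k : ℕ} (hk : k + 1 < n) (hk' : k % 2 = 0) : σ k < σ (k + 1) :=
  (h.alt k hk).1 (Nat.even_iff.mpr hk')

theorem alt_odd (h : IsDAB n σ) {k : ℕ} (hk : k + 1 < n) (hk' : k % 2 = 1) : σ (k + 1) < σ k :=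
  (h.alt k hk).2 (Nat.odd_iff.mpr hk')

theorem symm_even (h : IsDAB n σ) {k : ℕ} (hk : k + 1 < n) (hk' : k % 2 = 0) :
    σ.symm k < σ.symm (k + 1) :=
  (h.alt_symm k hk).1 (Nat.even_iff.mpr hk')

theorem symm_odd (h : IsDAB n σ) {k : ℕ} (hk : k + 1 < n) (hk' : k % 2 = 1) :
    σ.symm (k + 1) < σ.symm k :=
  (h.alt_symm k hk).2 (Nat.odd_iff.mpr hk')

/-- The first value is even, since the inverse has a valley there. -/
theorem apply_zero_even (h : IsDAB (2 * m) σ) (hm : 0 < m) : σ 0 % 2 = 0 := by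
  by_contra hodd
  have h0 : σ 0 < 2 * m := (Equiv.Perm.lt_iff_lt_of_fix h.fix 0).mpr (by omega)
  have := h.symm_even (k := σ 0 - 1) (by omega) (by omega)
  rw [Nat.sub_add_cancel (by omega), Equiv.symm_apply_apply] at this
  omega

/-- An ascent of `σ` at `j` that ends above `σ 0` crosses an ascent `s, s + 1` of the inverse with
`σ 0 ≤ s`: take for `s` the largest value below `σ (j + 1)` seen so far. -/
theorem exists_crossing (h : IsDAB n σ) {j : ℕ} (hj : j + 1 < n) (hv : σ 0 < σ (j + 1))
    (hjj : σ j < σ (j + 1)) :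
    ∃ s, s % 2 = 0 ∧ σ 0 ≤ s ∧ s + 1 < n ∧ σ j ≤ s ∧ s < σ (j + 1) ∧ σ.symm s ≤ j ∧
      j < σ.symm (s + 1) := by
  let S := (Finset.range (j + 1)).filter fun i ↦ σ i < σ (j + 1)
  have hS : S.Nonempty := ⟨0, by simp [S, hv]⟩
  obtain ⟨i, hi, hmax⟩ := S.exists_max_image σ hS
  simp only [S, Finset.mem_filter, Finset.mem_range] at hi hmax
  have hn : σ (j + 1) < n := (Equiv.Perm.lt_iff_lt_of_fix h.fix _).mpr hj
  have hpos : j < σ.symm (σ i + 1) := by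
    by_contra hle
    rcases Nat.lt_or_ge (σ i + 1) (σ (j + 1)) with hlt | hge
    · have := hmax (σ.symm (σ i + 1)) (by rw [Equiv.apply_symm_apply]; omega)
      rw [Equiv.apply_symm_apply] at this
      omega
    · have : σ i + 1 = σ (j + 1) := by omega
      rw [this, Equiv.symm_apply_apply] at hle
      omega
  refine ⟨σ i, ?_, hmax 0 (by omega), by omega, hmax j (by omega), hi.2, ?_, hpos⟩
  · by_contra hodd
    have := h.symm_odd (k := σ i) (by omega) (by omega)
    rw [Equiv.symm_apply_apply] at this
    omega
  · rw [Equiv.symm_apply_apply]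
    omega

/-- Two different ascents of `σ` cannot cross the same ascent of the inverse: between them `σ`
would descend across it, which is a forbidden pattern. -/
theorem crossing_inj (h : IsDAB n σ) {j j' s : ℕ} (hjj : j < j') (hs : s + 1 < n)
    (h1 : s < σ (j + 1)) (h2 : σ.symm s ≤ j) (h3 : σ j' ≤ s) (h4 : j' < σ.symm (s + 1)) :
    False := by
  obtain ⟨t, ht1, ht2, ht3, ht4⟩ :=
    Nat.exists_lt_and_not_succ (p := fun t ↦ s < σ t) (a := j + 1) (b := j') hjj h1 (by omega)
  have hlt : σ.symm (s + 1) < n := (Equiv.Perm.symm_lt_iff_lt_of_fix h.fix _).mpr hs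
  refine h.baxter (σ.symm s) t (σ.symm (s + 1)) (by omega) (by omega) hlt (Or.inl ?_)
  rw [Equiv.apply_symm_apply, Equiv.apply_symm_apply]
  have e1 : σ (t + 1) ≠ s := by
    intro e
    rw [← e, Equiv.symm_apply_apply] at h2
    omega
  have e2 : σ t ≠ s + 1 := by
    intro e
    rw [← e, Equiv.symm_apply_apply] at h4
    omega
  omega

/-- At most half of the values that are at least `σ 0` stand at odd positions. -/
theorem card_odd_above_le (h : IsDAB (2 * m) σ) (hm : 0 < m) :
    ((Finset.range m).filter fun k ↦ σ 0 < σ (2 * k + 1)).card ≤ m - σ 0 / 2 := by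
  have h0 := h.apply_zero_even hm
  have key : ∀ k, k < m → σ 0 < σ (2 * k + 1) → ∃ s, s % 2 = 0 ∧ σ 0 ≤ s ∧ s + 1 < 2 * m ∧
      σ (2 * k) ≤ s ∧ s < σ (2 * k + 1) ∧ σ.symm s ≤ 2 * k ∧ 2 * k < σ.symm (s + 1) :=
    fun k hk hv ↦ h.exists_crossing (by omega) hv (h.alt_even (by omega) (by omega))
  choose! s hs using key
  rw [← Nat.card_Ico]
  refine Finset.card_le_card_of_injOn (fun k ↦ s k / 2) ?_ ?_
  · intro k hk
    simp only [Finset.coe_filter, Finset.mem_range, Set.mem_ofPred_eq] at hk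
    have := hs k hk.1 hk.2
    simp only [Finset.coe_Ico, Set.mem_Ico]
    omega
  · intro k hk k' hk' he
    simp only [Finset.coe_filter, Finset.mem_range, Set.mem_ofPred_eq] at hk hk' he
    obtain ⟨a1, a2, a3, a4, a5, a6, a7⟩ := hs k hk.1 hk.2
    obtain ⟨b1, b2, b3, b4, b5, b6, b7⟩ := hs k' hk'.1 hk'.2
    have hss : s k = s k' := by omega
    rw [hss] at a3 a4 a5 a6 a7
    rcases lt_trichotomy k k' with hlt | heq | hgt
    · exact (h.crossing_inj (j := 2 * k) (j' := 2 * k') (by omega) b3 a5 a6 b4 b7).elim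
    · exact heq
    · exact (h.crossing_inj (j := 2 * k') (j' := 2 * k) (by omega) b3 b5 b6 a4 a7).elim

theorem card_values_ge (h : ∀ k, n ≤ k → σ k = k) (v : ℕ) :
    ((Finset.range n).filter fun k ↦ v ≤ σ k).card = n - v := by
  rw [← Nat.card_Ico]
  refine Finset.card_nbij' σ σ.symm ?_ ?_ ?_ ?_
  · intro k hk
    simp only [Finset.coe_filter, Finset.mem_range, Set.mem_ofPred_eq, Finset.coe_Ico,
      Set.mem_Ico] at hk ⊢
    exact ⟨hk.2, (Equiv.Perm.lt_iff_lt_of_fix h k).mpr hk.1⟩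
  · intro k hk
    simp only [Finset.coe_filter, Finset.mem_range, Set.mem_ofPred_eq, Finset.coe_Ico,
      Set.mem_Ico] at hk ⊢
    exact ⟨(Equiv.Perm.symm_lt_iff_lt_of_fix h k).mpr hk.2, by simpa using hk.1⟩
  · intro k _
    simp
  · intro k _
    simp

/-- Every peak above `σ 0` is preceded by a valley that is at least `σ 0`: otherwise more than half
of the values `≥ σ 0` would stand at odd positions. -/
theorem le_apply_even (h : IsDAB (2 * m) σ) {k : ℕ} (hk : k < m)
    (hv : σ 0 < σ (2 * k + 1)) : σ 0 ≤ σ (2 * k) := by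
  have hm : 0 < m := by omega
  have h0 := h.apply_zero_even hm
  let A := (Finset.range m).filter fun k ↦ σ 0 < σ (2 * k + 1)
  let B := (Finset.range m).filter fun k ↦ σ 0 ≤ σ (2 * k)
  have hA : A.card ≤ m - σ 0 / 2 := h.card_odd_above_le hm
  have hBA : B ⊆ A := by
    intro i hi
    simp only [A, B, Finset.mem_filter, Finset.mem_range] at hi ⊢
    exact ⟨hi.1, hi.2.trans_lt (h.alt_even (by omega) (by omega))⟩
  have hsplit : (Finset.range (2 * m)).filter (fun k ↦ σ 0 ≤ σ k) =
      A.image (fun k ↦ 2 * k + 1) ∪ B.image (fun k ↦ 2 * k) := by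
    ext i
    simp only [A, B, Finset.mem_filter, Finset.mem_range, Finset.mem_union, Finset.mem_image]
    constructor
    · rintro ⟨hi, hle⟩
      rcases Nat.mod_two_eq_zero_or_one i with hp | hp
      · exact Or.inr ⟨i / 2, ⟨by omega, by rwa [show 2 * (i / 2) = i by omega]⟩, by omega⟩
      · have hne : σ 0 ≠ σ i := fun e ↦ by
          have := σ.injective e
          omega
        exact Or.inl ⟨i / 2, ⟨by omega, by
          rw [show 2 * (i / 2) + 1 = i by omega]; omega⟩, by omega⟩
    · rintro (⟨a, ⟨ha, ha'⟩, rfl⟩ | ⟨a, ⟨ha, ha'⟩, rfl⟩)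
      · exact ⟨by omega, ha'.le⟩
      · exact ⟨by omega, ha'⟩
  have hcard := card_values_ge h.fix (σ 0)
  have hle : 2 * m - σ 0 ≤ A.card + B.card := by
    rw [← hcard, hsplit]
    exact (Finset.card_union_le _ _).trans (add_le_add Finset.card_image_le Finset.card_image_le)
  have hAB : B = A := Finset.eq_of_subset_of_card_le hBA (by omega)
  have hkA : k ∈ A := by simp [A, hk, hv]
  rw [← hAB] at hkA
  simp only [B, Finset.mem_filter] at hkA
  exact hkA.2

/-- The positions of the values `≥ σ 0` form an initial segment. -/
theorem apply_zero_le_iff (h : IsDAB (2 * m) σ) {k : ℕ} (hk : k < 2 * m) :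
    σ 0 ≤ σ k ↔ k < 2 * m - σ 0 := by
  have hdown : ∀ i j, i ≤ j → j < 2 * m → σ 0 ≤ σ j → σ 0 ≤ σ i := by
    intro i j hij hj hle
    by_contra hlt
    obtain ⟨t, ht1, ht2, ht3, ht4⟩ := Nat.exists_lt_and_not_succ
      (p := fun t ↦ ¬ σ 0 ≤ σ t) hij hlt (not_not.mpr hle)
    rw [not_not] at ht4
    rcases Nat.mod_two_eq_zero_or_one t with hp | hp
    · have hne : σ 0 ≠ σ (t + 1) := fun e ↦ by
        have := σ.injective e
        omega
      have := h.le_apply_even (k := t / 2) (by omega)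
        (by rw [show 2 * (t / 2) + 1 = t + 1 by omega]; omega)
      rw [show 2 * (t / 2) = t by omega] at this
      exact ht3 this
    · have := h.alt_odd (k := t) (by omega) hp
      omega
  have hcard := card_values_ge h.fix (σ 0)
  constructor
  · intro hle
    have hsub : Finset.range (k + 1) ⊆ (Finset.range (2 * m)).filter fun k ↦ σ 0 ≤ σ k := by
      intro i hi
      simp only [Finset.mem_range, Finset.mem_filter] at hi ⊢
      exact ⟨by omega, hdown i k (by omega) hk hle⟩
    have := Finset.card_le_card hsub
    rw [Finset.card_range, hcard] at this
    omega
  · intro hlt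
    by_contra hle
    have hsub : ((Finset.range (2 * m)).filter fun k ↦ σ 0 ≤ σ k) ⊆ Finset.range k := by
      intro i hi
      simp only [Finset.mem_range, Finset.mem_filter] at hi ⊢
      by_contra hki
      exact hle (hdown k i (by omega) hi.1 hi.2)
    have := Finset.card_le_card hsub
    rw [Finset.card_range, hcard] at this
    omega

end IsDAB

/-! ### Skew sums, capped complements and the decomposition -/

/-- The skew sum `A ⊖ B` of a permutation `A` of size `p` and a permutation `B` of size `s`. -/
def skewSum (p s : ℕ) (A B : Equiv.Perm ℕ) (hA : ∀ k, p ≤ k → A k = k) (hB : ∀ k, s ≤ k → B k = k) :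
    Equiv.Perm ℕ where
  toFun k := if k < p then s + A k else if k < p + s then B (k - p) else k
  invFun v := if v < s then p + B.symm v else if v < p + s then A.symm (v - s) else v
  left_inv k := by
    have a := Equiv.Perm.lt_iff_lt_of_fix hA k
    have b := Equiv.Perm.lt_iff_lt_of_fix hB (k - p)
    dsimp only
    by_cases h1 : k < p
    · rw [if_pos h1, if_neg (by omega), if_pos (by omega), Nat.add_sub_cancel_left,
        Equiv.symm_apply_apply]
    · rw [if_neg h1]
      by_cases h2 : k < p + s
      · rw [if_pos h2, if_pos (by omega), Equiv.symm_apply_apply]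
        omega
      · rw [if_neg h2, if_neg (by omega), if_neg h2]
  right_inv v := by
    have a := Equiv.Perm.symm_lt_iff_lt_of_fix hA (v - s)
    have b := Equiv.Perm.symm_lt_iff_lt_of_fix hB v
    dsimp only
    by_cases h1 : v < s
    · rw [if_pos h1, if_neg (by omega), if_pos (by omega), Nat.add_sub_cancel_left,
        Equiv.apply_symm_apply]
    · rw [if_neg h1]
      by_cases h2 : v < p + s
      · rw [if_pos h2, if_pos (by omega), Equiv.apply_symm_apply]
        omega
      · rw [if_neg h2, if_neg (by omega), if_neg h2]

/-- The permutation `1 ⊕ τᶜ ⊕ 1` of size `t + 2`, where `τᶜ` is the complement of the permutation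
`τ` of size `t`. -/
def cappedComplement (t : ℕ) (τ : Equiv.Perm ℕ) (hτ : ∀ k, t ≤ k → τ k = k) : Equiv.Perm ℕ where
  toFun k := if k = 0 then 0 else if k ≤ t then t - τ (k - 1) else k
  invFun v := if v = 0 then 0 else if v ≤ t then τ.symm (t - v) + 1 else v
  left_inv k := by
    have a := Equiv.Perm.lt_iff_lt_of_fix hτ (k - 1)
    dsimp only
    by_cases h1 : k = 0
    · rw [if_pos h1, if_pos rfl, h1]
    · rw [if_neg h1]
      by_cases h2 : k ≤ t
      · rw [if_pos h2, if_neg (by omega), if_pos (by omega), Nat.sub_sub_self (by omega),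
          Equiv.symm_apply_apply]
        omega
      · rw [if_neg h2, if_neg h1, if_neg h2]
  right_inv v := by
    have a := Equiv.Perm.symm_lt_iff_lt_of_fix hτ (t - v)
    dsimp only
    by_cases h1 : v = 0
    · rw [if_pos h1, if_pos rfl, h1]
    · rw [if_neg h1]
      by_cases h2 : v ≤ t
      · rw [if_pos h2, if_neg (by omega), if_pos (by omega), Nat.add_sub_cancel,
          Equiv.apply_symm_apply]
        omega
      · rw [if_neg h2, if_neg h1, if_neg h2]

/-- The reverse-complement of a permutation of size `n`. -/
def reverseComplement (n : ℕ) (σ : Equiv.Perm ℕ) (hσ : ∀ k, n ≤ k → σ k = k) : Equiv.Perm ℕ where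
  toFun k := if k < n then n - 1 - σ (n - 1 - k) else k
  invFun v := if v < n then n - 1 - σ.symm (n - 1 - v) else v
  left_inv k := by
    have a := Equiv.Perm.lt_iff_lt_of_fix hσ (n - 1 - k)
    dsimp only
    by_cases h1 : k < n
    · rw [if_pos h1, if_pos (by omega), Nat.sub_sub_self (by omega), Equiv.symm_apply_apply]
      omega
    · rw [if_neg h1, if_neg h1]
  right_inv v := by
    have a := Equiv.Perm.symm_lt_iff_lt_of_fix hσ (n - 1 - v)
    dsimp only
    by_cases h1 : v < n
    · rw [if_pos h1, if_pos (by omega), Nat.sub_sub_self (by omega), Equiv.apply_symm_apply]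
      omega
    · rw [if_neg h1, if_neg h1]

section skewSum

variable {p s : ℕ} {A B : Equiv.Perm ℕ} (hA : ∀ k, p ≤ k → A k = k) (hB : ∀ k, s ≤ k → B k = k)

theorem skewSum_left {k : ℕ} (hk : k < p) : skewSum p s A B hA hB k = s + A k := if_pos hk

theorem skewSum_right {k : ℕ} (hk : k < s) : skewSum p s A B hA hB (p + k) = B k := by
  change (if p + k < p then _ else if p + k < p + s then B (p + k - p) else _) = _
  rw [if_neg (by omega), if_pos (by omega), Nat.add_sub_cancel_left]

theorem skewSum_of_le {k : ℕ} (hk : p + s ≤ k) : skewSum p s A B hA hB k = k := by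
  change (if k < p then _ else if k < p + s then _ else k) = k
  rw [if_neg (by omega), if_neg (by omega)]

theorem skewSum_symm_low {v : ℕ} (hv : v < s) : (skewSum p s A B hA hB).symm v = p + B.symm v :=
  if_pos hv

theorem skewSum_symm_high {v : ℕ} (hv : v < p) :
    (skewSum p s A B hA hB).symm (s + v) = A.symm v := by
  change (if s + v < s then _ else if s + v < p + s then A.symm (s + v - s) else _) = _
  rw [if_neg (by omega), if_pos (by omega), Nat.add_sub_cancel_left]

theorem IsDAB.left_of_skewSum (h : IsDAB (p + s) (skewSum p s A B hA hB)) (hs : s % 2 = 0) :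
    IsDAB p A where
  fix := hA
  baxter i j k hij hjk hk := by
    have := h.baxter i j k hij hjk (by omega)
    rw [skewSum_left hA hB (by omega), skewSum_left hA hB (by omega), skewSum_left hA hB (by omega),
      skewSum_left hA hB (by omega)] at this
    omega
  alt k hk := by
    have := h.alt k (by omega)
    rw [skewSum_left hA hB (by omega), skewSum_left hA hB (by omega)] at this
    exact ⟨fun e ↦ by have := this.1 e; omega, fun e ↦ by have := this.2 e; omega⟩
  alt_symm k hk := by
    have := h.alt_symm (s + k) (by omega)
    rw [add_assoc, skewSum_symm_high hA hB (by omega), skewSum_symm_high hA hB (by omega)] at this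
    rw [Nat.even_iff, Nat.odd_iff] at this ⊢
    omega

theorem IsDAB.right_of_skewSum (h : IsDAB (p + s) (skewSum p s A B hA hB)) (hp : p % 2 = 0) :
    IsDAB s B where
  fix := hB
  baxter i j k hij hjk hk := by
    have := h.baxter (p + i) (p + j) (p + k) (by omega) (by omega) (by omega)
    rwa [add_assoc, skewSum_right hA hB (by omega), skewSum_right hA hB (by omega),
      skewSum_right hA hB (by omega), skewSum_right hA hB (by omega)] at this
  alt k hk := by
    have := h.alt (p + k) (by omega)
    rw [add_assoc, skewSum_right hA hB (by omega), skewSum_right hA hB (by omega)] at this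
    rw [Nat.even_iff, Nat.odd_iff] at this ⊢
    omega
  alt_symm k hk := by
    have := h.alt_symm k (by omega)
    rw [skewSum_symm_low hA hB (by omega), skewSum_symm_low hA hB (by omega)] at this
    exact ⟨fun e ↦ by have := this.1 e; omega, fun e ↦ by have := this.2 e; omega⟩

theorem isDAB_skewSum (h : IsDAB p A) (h' : IsDAB s B) (hp : p % 2 = 0) (hs : s % 2 = 0) :
    IsDAB (p + s) (skewSum p s A B h.fix h'.fix) := by
  have hA := h.fix
  have hB := h'.fix
  -- Positions and values split into the two blocks.
  have cases : ∀ k, k < p + s →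
      (k < p ∧ skewSum p s A B hA hB k = s + A k ∧ A k < p) ∨
      (p ≤ k ∧ skewSum p s A B hA hB k = B (k - p) ∧ B (k - p) < s) := by
    intro k hk
    rcases Nat.lt_or_ge k p with hlt | hge
    · exact Or.inl ⟨hlt, skewSum_left hA hB hlt, (Equiv.Perm.lt_iff_lt_of_fix hA k).mpr hlt⟩
    · refine Or.inr ⟨hge, ?_, (Equiv.Perm.lt_iff_lt_of_fix hB (k - p)).mpr (by omega)⟩
      rw [← skewSum_right hA hB (by omega), Nat.add_sub_cancel' hge]
  have cases_symm : ∀ v, v < p + s →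
      (v < s ∧ (skewSum p s A B hA hB).symm v = p + B.symm v ∧ B.symm v < s) ∨
      (s ≤ v ∧ (skewSum p s A B hA hB).symm v = A.symm (v - s) ∧ A.symm (v - s) < p) := by
    intro v hv
    rcases Nat.lt_or_ge v s with hlt | hge
    · exact Or.inl ⟨hlt, skewSum_symm_low hA hB hlt,
        (Equiv.Perm.symm_lt_iff_lt_of_fix hB v).mpr hlt⟩
    · refine Or.inr ⟨hge, ?_, (Equiv.Perm.symm_lt_iff_lt_of_fix hA (v - s)).mpr (by omega)⟩
      rw [← skewSum_symm_high hA hB (by omega), Nat.add_sub_cancel' hge]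
  refine ⟨fun k hk ↦ skewSum_of_le hA hB hk, ?_, ?_, ?_⟩
  · intro i j k hij hjk hk
    rcases cases i (by omega) with ⟨i1, i2, i3⟩ | ⟨i1, i2, i3⟩ <;>
    rcases cases j (by omega) with ⟨j1, j2, j3⟩ | ⟨j1, j2, j3⟩ <;>
    rcases cases (j + 1) (by omega) with ⟨l1, l2, l3⟩ | ⟨l1, l2, l3⟩ <;>
    rcases cases k (by omega) with ⟨k1, k2, k3⟩ | ⟨k1, k2, k3⟩ <;>
    try omega
    · have := h.baxter i j k hij hjk k1
      omega
    · have := h'.baxter (i - p) (j - p) (k - p) (by omega) (by omega) (by omega)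
      rw [← Nat.sub_add_comm j1] at this
      omega
  · intro k hk
    rw [Nat.even_iff, Nat.odd_iff]
    rcases cases k (by omega) with ⟨k1, k2, k3⟩ | ⟨k1, k2, k3⟩ <;>
    rcases cases (k + 1) (by omega) with ⟨l1, l2, l3⟩ | ⟨l1, l2, l3⟩ <;>
    try omega
    · have := h.alt k l1
      rw [Nat.even_iff, Nat.odd_iff] at this
      omega
    · have := h'.alt (k - p) (by omega)
      rw [Nat.even_iff, Nat.odd_iff, ← Nat.sub_add_comm k1] at this
      omega
  · intro k hk
    rw [Nat.even_iff, Nat.odd_iff]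
    rcases cases_symm k (by omega) with ⟨k1, k2, k3⟩ | ⟨k1, k2, k3⟩ <;>
    rcases cases_symm (k + 1) (by omega) with ⟨l1, l2, l3⟩ | ⟨l1, l2, l3⟩ <;>
    try omega
    · have := h'.alt_symm k l1
      rw [Nat.even_iff, Nat.odd_iff] at this
      omega
    · have := h.alt_symm (k - s) (by omega)
      rw [Nat.even_iff, Nat.odd_iff, ← Nat.sub_add_comm k1] at this
      omega

/-- A permutation whose values `≥ s` occupy exactly the first `p` positions is a skew sum. -/
theorem exists_eq_skewSum {σ : Equiv.Perm ℕ} (hσ : ∀ k, p + s ≤ k → σ k = k)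
    (h : ∀ k, k < p + s → (s ≤ σ k ↔ k < p)) :
    ∃ A B hA hB, σ = skewSum p s A B hA hB := by
  have hσ' := Equiv.Perm.lt_iff_lt_of_fix hσ
  have hs : ∀ v, v < p + s → (s ≤ v ↔ σ.symm v < p) := fun v hv ↦ by
    have := h (σ.symm v) ((Equiv.Perm.symm_lt_iff_lt_of_fix hσ v).mpr hv)
    rwa [Equiv.apply_symm_apply] at this
  have hσs := Equiv.Perm.symm_lt_iff_lt_of_fix hσ
  let A : Equiv.Perm ℕ :=
    { toFun := fun k ↦ if k < p then σ k - s else k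
      invFun := fun u ↦ if u < p then σ.symm (u + s) else u
      left_inv := fun k ↦ by
        have h1 := h k
        have h2 := hσ' k
        dsimp only
        by_cases hk : k < p
        · rw [if_pos hk, if_pos (by omega), Nat.sub_add_cancel (by omega), Equiv.symm_apply_apply]
        · rw [if_neg hk, if_neg hk]
      right_inv := fun u ↦ by
        have h1 := hs (u + s)
        dsimp only
        by_cases hu : u < p
        · rw [if_pos hu, if_pos (by omega), Equiv.apply_symm_apply, Nat.add_sub_cancel]
        · rw [if_neg hu, if_neg hu] }
  let B : Equiv.Perm ℕ :=
    { toFun := fun k ↦ if k < s then σ (p + k) else k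
      invFun := fun u ↦ if u < s then σ.symm u - p else u
      left_inv := fun k ↦ by
        have h1 := h (p + k)
        dsimp only
        by_cases hk : k < s
        · rw [if_pos hk, if_pos (by omega), Equiv.symm_apply_apply, Nat.add_sub_cancel_left]
        · rw [if_neg hk, if_neg hk]
      right_inv := fun u ↦ by
        have h1 := hs u
        have h2 := hσs u
        dsimp only
        by_cases hu : u < s
        · rw [if_pos hu, if_pos (by omega), Nat.add_sub_cancel' (by omega), Equiv.apply_symm_apply]
        · rw [if_neg hu, if_neg hu] }
  have hA : ∀ k, p ≤ k → A k = k := fun k hk ↦ if_neg (by omega)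
  have hB : ∀ k, s ≤ k → B k = k := fun k hk ↦ if_neg (by omega)
  refine ⟨A, B, hA, hB, Equiv.ext fun k ↦ ?_⟩
  rcases Nat.lt_or_ge k p with hlt | hge
  · have := h k (by omega)
    rw [skewSum_left hA hB hlt]
    change _ = s + if k < p then σ k - s else k
    rw [if_pos hlt]
    omega
  · rcases Nat.lt_or_ge k (p + s) with hlt' | hge'
    · obtain ⟨l, rfl⟩ := Nat.exists_eq_add_of_le hge
      rw [skewSum_right hA hB (by omega)]
      exact (if_pos (by omega)).symm
    · rw [skewSum_of_le hA hB hge', hσ k hge']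

end skewSum

section cappedComplement

variable {t : ℕ} {τ : Equiv.Perm ℕ} (hτ : ∀ k, t ≤ k → τ k = k)

theorem cappedComplement_succ {k : ℕ} (hk : k < t) :
    cappedComplement t τ hτ (k + 1) = t - τ k := by
  change (if k + 1 = 0 then 0 else if k + 1 ≤ t then t - τ (k + 1 - 1) else k + 1) = _
  rw [if_neg (by omega), if_pos (by omega), Nat.add_sub_cancel]

theorem cappedComplement_of_lt {k : ℕ} (hk : t < k) : cappedComplement t τ hτ k = k := by
  change (if k = 0 then _ else if k ≤ t then _ else k) = _
  rw [if_neg (by omega), if_neg (by omega)]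

theorem cappedComplement_symm_sub {v : ℕ} (hv : v < t) :
    (cappedComplement t τ hτ).symm (t - v) = τ.symm v + 1 := by
  change (if t - v = 0 then _ else if t - v ≤ t then τ.symm (t - (t - v)) + 1 else _) = _
  rw [if_neg (by omega), if_pos (by omega), Nat.sub_sub_self hv.le]

theorem cappedComplement_symm_of_lt {v : ℕ} (hv : t < v) :
    (cappedComplement t τ hτ).symm v = v := by
  change (if v = 0 then _ else if v ≤ t then _ else v) = _
  rw [if_neg (by omega), if_neg (by omega)]

theorem IsDAB.of_cappedComplement (h : IsDAB (t + 2) (cappedComplement t τ hτ))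
    (ht : t % 2 = 0) : IsDAB t τ where
  fix := hτ
  baxter i j k hij hjk hk := by
    have hlt := Equiv.Perm.lt_iff_lt_of_fix hτ
    have h1 := hlt i
    have h2 := hlt j
    have h3 := hlt (j + 1)
    have h4 := hlt k
    have := h.baxter (i + 1) (j + 1) (k + 1) (by omega) (by omega) (by omega)
    rw [cappedComplement_succ hτ (by omega), cappedComplement_succ hτ (by omega),
      cappedComplement_succ hτ (by omega), cappedComplement_succ hτ (by omega)] at this
    omega
  alt k hk := by
    have hlt := Equiv.Perm.lt_iff_lt_of_fix hτ
    have h1 := hlt k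
    have h2 := hlt (k + 1)
    have := h.alt (k + 1) (by omega)
    rw [cappedComplement_succ hτ (by omega), cappedComplement_succ hτ (by omega)] at this
    rw [Nat.even_iff, Nat.odd_iff] at this ⊢
    omega
  alt_symm k hk := by
    have := h.alt_symm (t - (k + 1)) (by omega)
    rw [show t - (k + 1) + 1 = t - k by omega, cappedComplement_symm_sub hτ (by omega),
      cappedComplement_symm_sub hτ (by omega)] at this
    rw [Nat.even_iff, Nat.odd_iff] at this ⊢
    omega

theorem isDAB_cappedComplement (h : IsDAB t τ) (ht : t % 2 = 0) :
    IsDAB (t + 2) (cappedComplement t τ h.fix) := by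
  have hτ := h.fix
  have cases : ∀ k, (k = 0 ∧ cappedComplement t τ hτ k = 0) ∨
      (0 < k ∧ k ≤ t ∧ cappedComplement t τ hτ k = t - τ (k - 1) ∧ τ (k - 1) < t) ∨
      (t < k ∧ cappedComplement t τ hτ k = k) := by
    intro k
    rcases Nat.eq_zero_or_pos k with rfl | hk
    · exact Or.inl ⟨rfl, rfl⟩
    · rcases Nat.lt_or_ge t k with hlt | hge
      · exact Or.inr (Or.inr ⟨hlt, cappedComplement_of_lt hτ hlt⟩)
      · refine Or.inr (Or.inl ⟨hk, hge, ?_,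
          (Equiv.Perm.lt_iff_lt_of_fix hτ (k - 1)).mpr (by omega)⟩)
        rw [← cappedComplement_succ hτ (by omega), Nat.sub_add_cancel hk]
  have cases_symm : ∀ v, (v = 0 ∧ (cappedComplement t τ hτ).symm v = 0) ∨
      (0 < v ∧ v ≤ t ∧ (cappedComplement t τ hτ).symm v = τ.symm (t - v) + 1 ∧
        τ.symm (t - v) < t) ∨
      (t < v ∧ (cappedComplement t τ hτ).symm v = v) := by
    intro v
    rcases Nat.eq_zero_or_pos v with rfl | hv
    · exact Or.inl ⟨rfl, rfl⟩
    · rcases Nat.lt_or_ge t v with hlt | hge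
      · exact Or.inr (Or.inr ⟨hlt, cappedComplement_symm_of_lt hτ hlt⟩)
      · refine Or.inr (Or.inl ⟨hv, hge, ?_,
          (Equiv.Perm.symm_lt_iff_lt_of_fix hτ (t - v)).mpr (by omega)⟩)
        rw [← cappedComplement_symm_sub hτ (by omega), Nat.sub_sub_self hge]
  refine ⟨fun k hk ↦ cappedComplement_of_lt hτ (by omega), ?_, ?_, ?_⟩
  · intro i j k hij hjk hk
    rcases cases i with ⟨i1, i2⟩ | ⟨i0, i1, i2, i3⟩ | ⟨i1, i2⟩
    · omega
    · rcases cases j with ⟨j1, j2⟩ | ⟨j0, j1, j2, j3⟩ | ⟨j1, j2⟩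
      · omega
      · rcases cases (j + 1) with ⟨l1, l2⟩ | ⟨l0, l1, l2, l3⟩ | ⟨l1, l2⟩
        · omega
        · rcases cases k with ⟨k1, k2⟩ | ⟨k0, k1, k2, k3⟩ | ⟨k1, k2⟩
          · omega
          · have := h.baxter (i - 1) (j - 1) (k - 1) (by omega) (by omega) (by omega)
            rw [Nat.sub_add_cancel j0] at this
            rw [Nat.add_sub_cancel] at l2 l3
            omega
          · omega
        · have : k = j + 1 := by omega
          subst this
          omega
      · omega
    · omega
  · intro k hk
    rw [Nat.even_iff, Nat.odd_iff]
    rcases cases k with ⟨k1, k2⟩ | ⟨k0, k1, k2, k3⟩ | ⟨k1, k2⟩ <;>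
    rcases cases (k + 1) with ⟨l1, l2⟩ | ⟨l0, l1, l2, l3⟩ | ⟨l1, l2⟩ <;>
    try omega
    have := h.alt (k - 1) (by omega)
    rw [Nat.even_iff, Nat.odd_iff, Nat.sub_add_cancel k0] at this
    rw [Nat.add_sub_cancel] at l2 l3
    omega
  · intro k hk
    rw [Nat.even_iff, Nat.odd_iff]
    rcases cases_symm k with ⟨k1, k2⟩ | ⟨k0, k1, k2, k3⟩ | ⟨k1, k2⟩ <;>
    rcases cases_symm (k + 1) with ⟨l1, l2⟩ | ⟨l0, l1, l2, l3⟩ | ⟨l1, l2⟩ <;>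
    try omega
    have := h.alt_symm (t - (k + 1)) (by omega)
    rw [Nat.even_iff, Nat.odd_iff, show t - (k + 1) + 1 = t - k by omega] at this
    omega

/-- A permutation of size `t + 2` that fixes `0` and `t + 1` has the form `1 ⊕ τᶜ ⊕ 1`. -/
theorem exists_eq_cappedComplement {σ : Equiv.Perm ℕ} (h0 : σ 0 = 0)
    (hσ : ∀ k, t < k → σ k = k) : ∃ τ hτ, σ = cappedComplement t τ hτ := by
  have hmid : ∀ k, 0 < σ k ∧ σ k ≤ t ↔ 0 < k ∧ k ≤ t := fun k ↦ by
    have h1 := Equiv.Perm.lt_iff_lt_of_fix (n := t + 1) hσ k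
    have h2 : σ k = 0 ↔ k = 0 := by rw [← σ.injective.eq_iff (a := k), h0]
    omega
  have hmid' : ∀ k, 0 < σ.symm k ∧ σ.symm k ≤ t ↔ 0 < k ∧ k ≤ t := fun k ↦ by
    rw [← hmid, Equiv.apply_symm_apply]
  let τ : Equiv.Perm ℕ :=
    { toFun := fun k ↦ if k < t then t - σ (k + 1) else k
      invFun := fun u ↦ if u < t then σ.symm (t - u) - 1 else u
      left_inv := fun k ↦ by
        have h1 := hmid (k + 1)
        dsimp only
        by_cases hk : k < t
        · rw [if_pos hk, if_pos (by omega), Nat.sub_sub_self (by omega), Equiv.symm_apply_apply,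
            Nat.add_sub_cancel]
        · rw [if_neg hk, if_neg hk]
      right_inv := fun u ↦ by
        have h1 := hmid' (t - u)
        dsimp only
        by_cases hu : u < t
        · rw [if_pos hu, if_pos (by omega), Nat.sub_add_cancel (by omega), Equiv.apply_symm_apply,
            Nat.sub_sub_self hu.le]
        · rw [if_neg hu, if_neg hu] }
  have hτ : ∀ k, t ≤ k → τ k = k := fun k hk ↦ if_neg (by omega)
  refine ⟨τ, hτ, Equiv.ext fun k ↦ ?_⟩
  rcases k with _ | k
  · exact h0
  · rcases Nat.lt_or_ge k t with hlt | hge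
    · have := hmid (k + 1)
      rw [cappedComplement_succ hτ hlt]
      change _ = t - if k < t then t - σ (k + 1) else k
      rw [if_pos hlt]
      omega
    · rw [cappedComplement_of_lt hτ (by omega), hσ _ (by omega)]

end cappedComplement

section reverseComplement

variable {n : ℕ} {σ : Equiv.Perm ℕ}

theorem reverseComplement_of_lt (hσ : ∀ k, n ≤ k → σ k = k) {k : ℕ} (hk : k < n) :
    reverseComplement n σ hσ k = n - 1 - σ (n - 1 - k) := if_pos hk

theorem reverseComplement_symm_of_lt (hσ : ∀ k, n ≤ k → σ k = k) {k : ℕ} (hk : k < n) :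
    (reverseComplement n σ hσ).symm k = n - 1 - σ.symm (n - 1 - k) := if_pos hk

theorem isDAB_reverseComplement (h : IsDAB n σ) (hn : n % 2 = 0) :
    IsDAB n (reverseComplement n σ h.fix) := by
  have hlt := Equiv.Perm.lt_iff_lt_of_fix h.fix
  have hlt' := Equiv.Perm.symm_lt_iff_lt_of_fix h.fix
  refine ⟨fun k hk ↦ if_neg (by omega), ?_, ?_, ?_⟩
  · intro i j k hij hjk hk
    rw [reverseComplement_of_lt h.fix (by omega), reverseComplement_of_lt h.fix (by omega),
      reverseComplement_of_lt h.fix (by omega), reverseComplement_of_lt h.fix (by omega)]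
    have h1 := hlt (n - 1 - i)
    have h2 := hlt (n - 1 - j)
    have h3 := hlt (n - 1 - (j + 1))
    have h4 := hlt (n - 1 - k)
    -- If `k = j + 1`, the pattern would require `σ k < σ k`.
    rcases Nat.lt_or_ge (j + 1) k with hlt | hge
    · have := h.baxter (n - 1 - k) (n - 1 - (j + 1)) (n - 1 - i) (by omega) (by omega) (by omega)
      rw [show n - 1 - (j + 1) + 1 = n - 1 - j by omega] at this
      omega
    · rw [show k = j + 1 by omega]
      omega
  · intro k hk
    rw [reverseComplement_of_lt h.fix (by omega), reverseComplement_of_lt h.fix (by omega)]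
    have h2 := hlt (n - 1 - k)
    have h3 := hlt (n - 1 - (k + 1))
    have := h.alt (n - 1 - (k + 1)) (by omega)
    rw [Nat.even_iff, Nat.odd_iff] at this ⊢
    rw [show n - 1 - (k + 1) + 1 = n - 1 - k by omega] at this
    omega
  · intro k hk
    rw [reverseComplement_symm_of_lt h.fix (by omega), reverseComplement_symm_of_lt h.fix (by omega)]
    have h2 := hlt' (n - 1 - k)
    have h3 := hlt' (n - 1 - (k + 1))
    have := h.alt_symm (n - 1 - (k + 1)) (by omega)
    rw [Nat.even_iff, Nat.odd_iff] at this ⊢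
    rw [show n - 1 - (k + 1) + 1 = n - 1 - k by omega] at this
    omega

end reverseComplement

/-- If the first value is the smallest one, then the last value is the largest one: otherwise the
reverse-complement would be a nontrivial skew sum. -/
theorem IsDAB.apply_last {m : ℕ} {σ : Equiv.Perm ℕ} (h : IsDAB (2 * m) σ) (hm : 0 < m)
    (h0 : σ 0 = 0) : σ (2 * m - 1) = 2 * m - 1 := by
  have hr := isDAB_reverseComplement h (by omega)
  have hle := hr.apply_zero_le_iff (k := 2 * m - 1) (by omega)
  have hlt := (Equiv.Perm.lt_iff_lt_of_fix h.fix (2 * m - 1)).mpr (by omega)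
  rw [reverseComplement_of_lt h.fix (by omega), reverseComplement_of_lt h.fix (by omega),
    Nat.sub_self, h0, Nat.sub_zero] at hle
  omega

/-- Every nonempty doubly alternating Baxter permutation of even length has the form
`(1 ⊕ τᶜ ⊕ 1) ⊖ ρ` with doubly alternating Baxter permutations `τ` and `ρ` of even length. -/
theorem IsDAB.exists_decomposition {m : ℕ} {σ : Equiv.Perm ℕ} (h : IsDAB (2 * (m + 1)) σ) :
    ∃ t s τ ρ, ∃ hτ : IsDAB (2 * t) τ, ∃ hρ : IsDAB (2 * s) ρ, t + s = m ∧
      σ = skewSum (2 * t + 2) (2 * s) (cappedComplement (2 * t) τ hτ.fix) ρ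
        (isDAB_cappedComplement hτ (by omega)).fix hρ.fix := by
  have hv := h.apply_zero_even (by omega)
  have hlt := (Equiv.Perm.lt_iff_lt_of_fix h.fix 0).mpr (by omega)
  obtain ⟨s, hs⟩ : ∃ s, σ 0 = 2 * s := ⟨σ 0 / 2, by omega⟩
  obtain ⟨t, rfl⟩ : ∃ t, m = t + s := ⟨m - s, by omega⟩
  have hsize : 2 * (t + s + 1) = (2 * t + 2) + 2 * s := by ring
  have hiff := fun k (hk : k < 2 * (t + s + 1)) ↦ h.apply_zero_le_iff hk
  rw [hs, hsize, Nat.add_sub_cancel] at hiff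
  rw [hsize] at h
  obtain ⟨A, ρ, hA, hρ, rfl⟩ := exists_eq_skewSum h.fix hiff
  have hA' := h.left_of_skewSum hA hρ (by omega)
  have hρ' := h.right_of_skewSum hA hρ (by omega)
  rw [skewSum_left hA hρ (by omega)] at hs
  have hA0 : A 0 = 0 := by omega
  have hlast := IsDAB.apply_last (m := t + 1) hA' (by omega) hA0
  obtain ⟨τ, hτ, rfl⟩ := exists_eq_cappedComplement (t := 2 * t) hA0 (fun k hk ↦ by
    rcases Nat.lt_or_ge k (2 * t + 2) with hlt | hge
    · rwa [show k = 2 * (t + 1) - 1 by omega]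
    · exact hA k hge)
  exact ⟨t, s, τ, ρ, hA'.of_cappedComplement hτ (by omega), hρ', rfl, rfl⟩

/-! ### Counting by the decomposition -/

/-- Doubly alternating Baxter permutations as permutations of `Fin n` and of `ℕ`. -/
def dabEquiv (n : ℕ) :
    {σ : Equiv.Perm ℕ // IsDAB n σ} ≃
      {π : Equiv.Perm (Fin n) // π ∈ doublyAlternatingBaxter n} where
  toFun σ :=
    ⟨{ toFun := fun k ↦ ⟨σ.1 k, (Equiv.Perm.lt_iff_lt_of_fix σ.2.fix k).mpr k.2⟩
       invFun := fun k ↦ ⟨σ.1.symm k, (Equiv.Perm.symm_lt_iff_lt_of_fix σ.2.fix k).mpr k.2⟩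
       left_inv := fun k ↦ Fin.ext (by simp)
       right_inv := fun k ↦ Fin.ext (by simp) }, by
      refine ⟨?_, ?_, ?_⟩
      · rintro ⟨i, j, j', k, hij, hjk, hj, h⟩
        refine σ.2.baxter i j k hij hjk k.2 ?_
        rw [← hj]
        exact h
      · intro k k' hk
        have := σ.2.alt k (by omega)
        rw [← hk] at this
        exact this
      · intro k k' hk
        have := σ.2.alt_symm k (by omega)
        rw [← hk] at this
        exact this⟩
  invFun π :=
    ⟨{ toFun := fun k ↦ if h : k < n then π.1 ⟨k, h⟩ else k
       invFun := fun k ↦ if h : k < n then π.1.symm ⟨k, h⟩ else k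
       left_inv := fun k ↦ by by_cases h : k < n <;> simp [h]
       right_inv := fun k ↦ by by_cases h : k < n <;> simp [h] }, by
      obtain ⟨π, h1, h2, h3⟩ := π
      refine ⟨fun k hk ↦ dif_neg (by omega), ?_, ?_, ?_⟩
      · intro i j k hij hjk hk h
        refine h1 ⟨⟨i, by omega⟩, ⟨j, by omega⟩, ⟨j + 1, by omega⟩, ⟨k, hk⟩, hij, hjk, rfl, ?_⟩
        simpa [hk, show i < n by omega, show j < n by omega, show j + 1 < n by omega] using h
      · intro k hk
        simpa [hk, show k < n by omega] using h2 ⟨k, by omega⟩ ⟨k + 1, hk⟩ rfl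
      · intro k hk
        change (Even k → (dite (k < n) (fun h ↦ (π.symm ⟨k, h⟩ : ℕ)) fun _ ↦ k) <
            dite (k + 1 < n) (fun h ↦ (π.symm ⟨k + 1, h⟩ : ℕ)) fun _ ↦ k + 1) ∧
          (Odd k → (dite (k + 1 < n) (fun h ↦ (π.symm ⟨k + 1, h⟩ : ℕ)) fun _ ↦ k + 1) <
            dite (k < n) (fun h ↦ (π.symm ⟨k, h⟩ : ℕ)) fun _ ↦ k)
        rw [dif_pos hk, dif_pos (show k < n by omega)]
        exact h3 ⟨k, by omega⟩ ⟨k + 1, hk⟩ rfl⟩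
  left_inv σ := by
    refine Subtype.ext (Equiv.ext fun k ↦ ?_)
    change (if h : k < n then σ.1 k else k) = σ.1 k
    split_ifs with h
    · rfl
    · exact (σ.2.fix k (by omega)).symm
  right_inv π := by
    refine Subtype.ext (Equiv.ext fun k ↦ Fin.ext ?_)
    change (if h : (k : ℕ) < n then (π.1 ⟨k, h⟩ : ℕ) else k) = π.1 k
    rw [dif_pos k.2]

instance (n : ℕ) : Finite {σ : Equiv.Perm ℕ // IsDAB n σ} := Finite.of_equiv _ (dabEquiv n).symm

/-- The number of doubly alternating Baxter permutations of length `n` with `σ i = j`, where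
positions and values are numbered from `0`. -/
noncomputable def dabNum (n i j : ℕ) : ℕ :=
  Nat.card {σ : {σ : Equiv.Perm ℕ // IsDAB n σ} // i < n ∧ σ.1 i = j}

theorem dabCount_eq_dabNum (m i j : ℕ) : dabCount m (i + 1) (j + 1) = dabNum (2 * m) i j := by
  rw [dabCount, dabNum, ← Nat.card_coe_set_eq]
  refine (Nat.card_congr (((dabEquiv (2 * m)).subtypeEquiv (q := fun π ↦
    ∃ k : Fin (2 * m), (k : ℕ) + 1 = i + 1 ∧ (π.1 k : ℕ) + 1 = j + 1) fun σ ↦ ?_).trans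
    (Equiv.subtypeSubtypeEquivSubtypeInter _ fun π : Equiv.Perm (Fin (2 * m)) ↦
      ∃ k : Fin (2 * m), (k : ℕ) + 1 = i + 1 ∧ (π k : ℕ) + 1 = j + 1))).symm
  constructor
  · rintro ⟨hi, rfl⟩
    exact ⟨⟨i, hi⟩, rfl, rfl⟩
  · rintro ⟨k, hk, hk'⟩
    obtain rfl : (k : ℕ) = i := by omega
    exact ⟨k.2, Nat.succ_injective hk'⟩

theorem dabNum_of_le {n i : ℕ} (h : n ≤ i) (j : ℕ) : dabNum n i j = 0 := by
  have : IsEmpty {σ : {σ : Equiv.Perm ℕ // IsDAB n σ} // i < n ∧ σ.1 i = j} :=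
    ⟨fun σ ↦ by have := σ.2.1; omega⟩
  exact Nat.card_of_isEmpty

/-- The permutation `(1 ⊕ τᶜ ⊕ 1) ⊖ ρ`. -/
def dabJoin (t s : ℕ) (τ : {τ // IsDAB (2 * t) τ}) (ρ : {ρ // IsDAB (2 * s) ρ}) : Equiv.Perm ℕ :=
  skewSum (2 * t + 2) (2 * s) (cappedComplement (2 * t) τ.1 τ.2.fix) ρ.1
    (isDAB_cappedComplement τ.2 (by omega)).fix ρ.2.fix

section dabJoin

variable {t s : ℕ} (τ : {τ // IsDAB (2 * t) τ}) (ρ : {ρ // IsDAB (2 * s) ρ})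

theorem isDAB_dabJoin : IsDAB (2 * (t + s + 1)) (dabJoin t s τ ρ) := by
  rw [show 2 * (t + s + 1) = 2 * t + 2 + 2 * s by ring]
  exact isDAB_skewSum (isDAB_cappedComplement τ.2 (by omega)) ρ.2 (by omega) (by omega)

theorem dabJoin_zero : dabJoin t s τ ρ 0 = 2 * s :=
  skewSum_left _ _ (by omega)

theorem dabJoin_inner {k : ℕ} (hk : k < 2 * t) :
    dabJoin t s τ ρ (k + 1) = 2 * s + (2 * t - τ.1 k) := by
  rw [dabJoin, skewSum_left _ _ (by omega), cappedComplement_succ _ hk]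

theorem dabJoin_cap : dabJoin t s τ ρ (2 * t + 1) = 2 * (t + s) + 1 := by
  rw [dabJoin, skewSum_left _ _ (by omega), cappedComplement_of_lt _ (by omega)]
  ring

theorem dabJoin_outer {k : ℕ} (hk : k < 2 * s) : dabJoin t s τ ρ (2 * t + 2 + k) = ρ.1 k :=
  skewSum_right _ _ hk

end dabJoin

/-- The Catalan decomposition of doubly alternating Baxter permutations of even length. -/
noncomputable def dabDecompositionEquiv (m : ℕ) :
    (Σ x : {x : ℕ × ℕ // x ∈ Finset.HasAntidiagonal.antidiagonal m},
      {τ // IsDAB (2 * x.1.1) τ} × {ρ // IsDAB (2 * x.1.2) ρ}) ≃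
      {σ // IsDAB (2 * (m + 1)) σ} :=
  Equiv.ofBijective
    (fun y ↦ ⟨dabJoin y.1.1.1 y.1.1.2 y.2.1 y.2.2, by
      have := isDAB_dabJoin y.2.1 y.2.2
      rwa [Finset.HasAntidiagonal.mem_antidiagonal.mp y.1.2] at this⟩) (by
    constructor
    · rintro ⟨⟨⟨t, s⟩, hx⟩, τ, ρ⟩ ⟨⟨⟨t', s'⟩, hx'⟩, τ', ρ'⟩ h
      have h0 : ∀ k, dabJoin t s τ ρ k = dabJoin t' s' τ' ρ' k :=
        fun k ↦ congrArg (fun σ : {σ // IsDAB (2 * (m + 1)) σ} ↦ σ.1 k) h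
      have e0 := h0 0
      rw [dabJoin_zero, dabJoin_zero] at e0
      obtain rfl : s = s' := by omega
      have e1 := Finset.HasAntidiagonal.mem_antidiagonal.mp hx
      have e2 := Finset.HasAntidiagonal.mem_antidiagonal.mp hx'
      obtain rfl : t = t' := by
        dsimp only at e1 e2
        omega
      have e3 : τ = τ' := Subtype.ext (Equiv.ext fun k ↦ by
        rcases Nat.lt_or_ge k (2 * t) with hk | hk
        · have e4 := h0 (k + 1)
          rw [dabJoin_inner _ _ hk, dabJoin_inner _ _ hk] at e4
          have e5 : τ.1 k < 2 * t := (Equiv.Perm.lt_iff_lt_of_fix τ.2.fix k).mpr hk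
          have e6 : τ'.1 k < 2 * t := (Equiv.Perm.lt_iff_lt_of_fix τ'.2.fix k).mpr hk
          omega
        · rw [τ.2.fix k hk, τ'.2.fix k hk])
      have e4 : ρ = ρ' := Subtype.ext (Equiv.ext fun k ↦ by
        rcases Nat.lt_or_ge k (2 * s) with hk | hk
        · have e5 := h0 (2 * t + 2 + k)
          rwa [dabJoin_outer _ _ hk, dabJoin_outer _ _ hk] at e5
        · rw [ρ.2.fix k hk, ρ'.2.fix k hk])
      rw [e3, e4]
    · rintro ⟨σ, hσ⟩
      obtain ⟨t, s, τ, ρ, hτ, hρ, hts, rfl⟩ := hσ.exists_decomposition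
      exact ⟨⟨⟨(t, s), Finset.HasAntidiagonal.mem_antidiagonal.mpr hts⟩, ⟨τ, hτ⟩, ⟨ρ, hρ⟩⟩, rfl⟩)

/-- There are `C_m` doubly alternating Baxter permutations of length `2 m`. -/
theorem card_isDAB (m : ℕ) : Nat.card {σ // IsDAB (2 * m) σ} = catalan m := by
  induction m using Nat.strong_induction_on with
  | _ m ih =>
    rcases m with _ | m
    · rw [catalan_zero, Nat.card_eq_one_iff_unique]
      refine ⟨⟨fun σ ρ ↦ Subtype.ext (Equiv.ext fun k ↦ ?_)⟩, ⟨1, ?_⟩⟩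
      · rw [σ.2.fix k (by omega), ρ.2.fix k (by omega)]
      · exact ⟨fun _ _ ↦ rfl, by omega, by omega, by omega⟩
    · rw [← Nat.card_congr (dabDecompositionEquiv m), Nat.card_sigma, catalan_succ',
        ← Finset.sum_coe_sort (Finset.HasAntidiagonal.antidiagonal m)]
      refine Finset.sum_congr rfl fun x _ ↦ ?_
      have hx := Finset.HasAntidiagonal.mem_antidiagonal.mp x.2
      rw [Nat.card_prod, ih _ (by omega), ih _ (by omega)]

theorem Nat.card_subtype_const {α : Type*} (p : Prop) [Decidable p] :
    Nat.card {_x : α // p} = if p then Nat.card α else 0 := by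
  split_ifs with h
  · exact Nat.card_congr (Equiv.subtypeUnivEquiv fun _ ↦ h)
  · have : IsEmpty {_x : α // p} := ⟨fun x ↦ h x.2⟩
    exact Nat.card_of_isEmpty

/-- The entries of `(1 ⊕ τᶜ ⊕ 1) ⊖ ρ` with position `i` and value `j`, counted over all `τ` and
`ρ`: such an entry is the first `1`, lies in `τᶜ`, is the second `1`, or lies in `ρ`. -/
theorem card_dabJoin_apply_eq (t s i j : ℕ) :
    Nat.card {x : {τ // IsDAB (2 * t) τ} × {ρ // IsDAB (2 * s) ρ} //
      i < 2 * (t + s + 1) ∧ dabJoin t s x.1 x.2 i = j} =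
    (if i = 0 ∧ j = 2 * s then catalan t * catalan s else 0) +
    (if 1 ≤ i ∧ j ≤ 2 * (t + s) then dabNum (2 * t) (i - 1) (2 * (t + s) - j) * catalan s else 0) +
    (if i = 2 * t + 1 ∧ j = 2 * (t + s) + 1 then catalan t * catalan s else 0) +
    (if 2 * t + 2 ≤ i then catalan t * dabNum (2 * s) (i - (2 * t + 2)) j else 0) := by
  have hcard : Nat.card ({τ // IsDAB (2 * t) τ} × {ρ // IsDAB (2 * s) ρ}) =
      catalan t * catalan s := by
    rw [Nat.card_prod, card_isDAB, card_isDAB]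
  rcases Nat.eq_zero_or_pos i with rfl | hi
  · rw [if_neg (c := 1 ≤ 0 ∧ _) (by omega), if_neg (c := 0 = 2 * t + 1 ∧ _) (by omega),
      if_neg (c := 2 * t + 2 ≤ 0) (by omega), ← hcard, ← Nat.card_subtype_const]
    refine Nat.card_congr (Equiv.subtypeEquivRight fun x ↦ ?_)
    rw [dabJoin_zero]
    omega
  rw [if_neg (c := i = 0 ∧ _) (by omega)]
  rcases Nat.lt_or_ge i (2 * t + 1) with hlt | hge
  · rw [if_neg (c := i = 2 * t + 1 ∧ _) (by omega), if_neg (c := 2 * t + 2 ≤ i) (by omega)]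
    obtain ⟨i, rfl⟩ := Nat.exists_eq_add_of_le' hi
    have hval := fun τ : {τ // IsDAB (2 * t) τ} ↦
      (Equiv.Perm.lt_iff_lt_of_fix τ.2.fix i).mpr (by omega)
    split_ifs with hj
    · rw [zero_add, add_zero, add_zero, dabNum, ← card_isDAB s, ← Nat.card_prod]
      refine Nat.card_congr ((Equiv.subtypeEquivRight fun x ↦ ?_).trans
        Equiv.prodSubtypeFstEquivSubtypeProd)
      have := hval x.1
      rw [dabJoin_inner _ _ (by omega), Nat.add_sub_cancel]
      omega
    · refine @Nat.card_of_isEmpty _ ⟨?_⟩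
      rintro ⟨x, hx⟩
      have := hval x.1
      rw [dabJoin_inner _ _ (by omega)] at hx
      omega
  rw [dabNum_of_le (n := 2 * t) (by omega), zero_mul, ite_self]
  rcases Nat.eq_or_lt_of_le hge with heq | hgt
  · rw [if_neg (c := 2 * t + 2 ≤ i) (by omega), ← hcard, ← Nat.card_subtype_const, zero_add,
      zero_add, add_zero]
    refine Nat.card_congr (Equiv.subtypeEquivRight fun x ↦ ?_)
    rw [← heq, dabJoin_cap]
    omega
  · obtain ⟨k, rfl⟩ := Nat.exists_eq_add_of_le (show 2 * t + 2 ≤ i from hgt)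
    rw [if_neg (c := _ ∧ j = 2 * (t + s) + 1) (by omega), if_pos (by omega), zero_add, zero_add,
      zero_add, Nat.add_sub_cancel_left, dabNum, ← card_isDAB t, ← Nat.card_prod]
    rcases Nat.lt_or_ge k (2 * s) with hk | hk
    · refine Nat.card_congr (((Equiv.prodComm _ _).subtypeEquiv fun x ↦ ?_).trans
        (Equiv.prodSubtypeFstEquivSubtypeProd (p := fun ρ : {ρ // IsDAB (2 * s) ρ} ↦
          k < 2 * s ∧ ρ.1 k = j) |>.trans (Equiv.prodComm _ _)))
      rw [dabJoin_outer _ _ hk, Equiv.prodComm_apply, Prod.fst_swap]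
      omega
    · have h1 : IsEmpty {x : {τ // IsDAB (2 * t) τ} × {ρ // IsDAB (2 * s) ρ} //
          2 * t + 2 + k < 2 * (t + s + 1) ∧ dabJoin t s x.1 x.2 (2 * t + 2 + k) = j} :=
        ⟨fun x ↦ by have := x.2.1; omega⟩
      have h2 : IsEmpty {ρ : {ρ // IsDAB (2 * s) ρ} // k < 2 * s ∧ ρ.1 k = j} :=
        ⟨fun x ↦ by have := x.2.1; omega⟩
      rw [Nat.card_of_isEmpty, Nat.card_of_isEmpty]

/-- A subtype of a sigma type, as the sigma type of its fibres. -/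
def Equiv.subtypeSigmaFibers {ι : Type*} {β : ι → Type*} (p : Sigma β → Prop) :
    {y : Sigma β // p y} ≃ Σ i, {b : β i // p ⟨i, b⟩} where
  toFun y := ⟨y.1.1, y.1.2, y.2⟩
  invFun y := ⟨⟨y.1, y.2.1⟩, y.2.2⟩

/-- The recursion for `dabNum` given by the Catalan decomposition. -/
theorem dabNum_succ (m i j : ℕ) :
    dabNum (2 * (m + 1)) i j = ∑ x ∈ Finset.HasAntidiagonal.antidiagonal m,
      ((if i = 0 ∧ j = 2 * x.2 then catalan x.1 * catalan x.2 else 0) +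
      (if 1 ≤ i ∧ j ≤ 2 * m then dabNum (2 * x.1) (i - 1) (2 * m - j) * catalan x.2 else 0) +
      (if i = 2 * x.1 + 1 ∧ j = 2 * m + 1 then catalan x.1 * catalan x.2 else 0) +
      (if 2 * x.1 + 2 ≤ i then catalan x.1 * dabNum (2 * x.2) (i - (2 * x.1 + 2)) j else 0)) := by
  rw [← Finset.sum_coe_sort (Finset.HasAntidiagonal.antidiagonal m), dabNum]
  have e := (dabDecompositionEquiv m).subtypeEquiv
    (p := fun y ↦ i < 2 * (m + 1) ∧ dabJoin y.1.1.1 y.1.1.2 y.2.1 y.2.2 i = j)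
    (q := fun σ ↦ i < 2 * (m + 1) ∧ σ.1 i = j) fun y ↦ Iff.rfl
  rw [← Nat.card_congr e, Nat.card_congr (Equiv.subtypeSigmaFibers _), Nat.card_sigma]
  refine Finset.sum_congr rfl fun x _ ↦ ?_
  have hx := Finset.HasAntidiagonal.mem_antidiagonal.mp x.2
  have := card_dabJoin_apply_eq x.1.1 x.1.2 i j
  rwa [hx] at this

/-! ### Catalan series at monomials and coefficients of series in three variables -/

section CatalanSeries

variable {ι : Type*}

/-- The Catalan generating function `∑ Cₙ Xⁿᵉ`, evaluated at the monomial with exponent `e ≠ 0`. -/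
noncomputable def catalanAt (e : ι →₀ ℕ) : MvPowerSeries ι ℤ :=
  (PowerSeries.mk fun n ↦ (catalan n : ℤ)).subst (MvPowerSeries.monomial e (1 : ℤ))

theorem catalanAt_eq {e : ι →₀ ℕ} (he : e ≠ 0) :
    catalanAt e = 1 + MvPowerSeries.monomial e 1 * catalanAt e ^ 2 := by
  have h : (PowerSeries.mk fun n ↦ (catalan n : ℤ)) =
      PowerSeries.map (Nat.castRingHom ℤ) PowerSeries.catalanSeries := by
    ext n
    simp
  have hs := PowerSeries.HasSubst.monomial (S := ℤ) he 1
  have key := congrArg (PowerSeries.map (Nat.castRingHom ℤ))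
    PowerSeries.catalanSeries_sq_mul_X_add_one
  rw [map_add, map_mul, map_pow, PowerSeries.map_X, map_one, ← h] at key
  have key' := congrArg (PowerSeries.substAlgHom (R := ℤ) hs) key
  rw [map_add, map_mul, map_pow, map_one (PowerSeries.substAlgHom hs), PowerSeries.substAlgHom_X,
    PowerSeries.coe_substAlgHom] at key'
  rw [← catalanAt] at key'
  linear_combination -key'

theorem coeff_catalanAt {e d : ι →₀ ℕ} (he : e ≠ 0) {N : ℕ} (hN : ∀ n, n • e ≤ d → n < N) :
    MvPowerSeries.coeff d (catalanAt e) =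
      ∑ n ∈ Finset.range N,
        MvPowerSeries.coeff d (MvPowerSeries.monomial (n • e) (catalan n : ℤ)) := by
  classical
  rw [catalanAt, PowerSeries.coeff_subst (PowerSeries.HasSubst.monomial he 1)]
  rw [finsum_eq_sum_of_support_subset (s := Finset.range N)]
  · refine Finset.sum_congr rfl fun n _ ↦ ?_
    rw [MvPowerSeries.monomial_pow, MvPowerSeries.coeff_monomial, MvPowerSeries.coeff_monomial]
    simp
  · intro n hn
    rw [Function.mem_support, MvPowerSeries.monomial_pow, MvPowerSeries.coeff_monomial] at hn
    rw [Finset.coe_range, Set.mem_Iio]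
    refine hN n ?_
    by_contra hne
    rw [if_neg (fun h ↦ hne h.ge), smul_zero] at hn
    exact hn rfl

theorem coeff_monomial_mul_catalanAt_mul {e d e' : ι →₀ ℕ} (he : e ≠ 0) (F : MvPowerSeries ι ℤ)
    {N : ℕ} (hN : ∀ n, n • e ≤ d → n < N) :
    MvPowerSeries.coeff d (MvPowerSeries.monomial e' 1 * catalanAt e * F) =
      ∑ n ∈ Finset.range N, if e' + n • e ≤ d then
        (catalan n : ℤ) * MvPowerSeries.coeff (d - (e' + n • e)) F else 0 := by
  classical
  rw [mul_comm (MvPowerSeries.monomial e' 1), mul_assoc, MvPowerSeries.coeff_mul]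
  have h1 : ∀ p ∈ Finset.HasAntidiagonal.antidiagonal d,
      MvPowerSeries.coeff p.1 (catalanAt e) *
        MvPowerSeries.coeff p.2 (MvPowerSeries.monomial e' 1 * F) =
      ∑ n ∈ Finset.range N,
        MvPowerSeries.coeff p.1 (MvPowerSeries.monomial (n • e) (catalan n : ℤ)) *
          MvPowerSeries.coeff p.2 (MvPowerSeries.monomial e' 1 * F) := by
    intro p hp
    have hle : p.1 ≤ d := Finset.HasAntidiagonal.mem_antidiagonal.mp hp ▸ le_self_add
    rw [coeff_catalanAt he (N := N) fun n hn ↦ hN n (hn.trans hle), Finset.sum_mul]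
  rw [Finset.sum_congr rfl h1, Finset.sum_comm]
  refine Finset.sum_congr rfl fun n _ ↦ ?_
  rw [← MvPowerSeries.coeff_mul, ← mul_assoc, MvPowerSeries.monomial_mul_monomial, mul_one,
    MvPowerSeries.coeff_monomial_mul, add_comm]

end CatalanSeries

/-- The coefficients of power series in three variables `z`, `x`, `y` are indexed by the exponent
vectors `(i, b, g)`. -/
noncomputable def expo (i b g : ℕ) : Fin 3 →₀ ℕ := Finsupp.equivFunOnFinite.symm ![i, b, g]

/-- The power series `∑ f i b g zⁱ xᵇ yᵍ`. -/
def seriesOf (f : ℕ → ℕ → ℕ → ℤ) : MvPowerSeries (Fin 3) ℤ := fun d ↦ f (d 0) (d 1) (d 2)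

section expo

variable {i b g i' b' g' : ℕ}

@[simp] theorem expo_zero : expo i b g 0 = i := rfl

@[simp] theorem expo_one : expo i b g 1 = b := rfl

@[simp] theorem expo_two : expo i b g 2 = g := rfl

theorem expo_eta (d : Fin 3 →₀ ℕ) : expo (d 0) (d 1) (d 2) = d := by
  ext k
  fin_cases k <;> rfl

theorem expo_le_iff : expo i b g ≤ expo i' b' g' ↔ i ≤ i' ∧ b ≤ b' ∧ g ≤ g' := by
  rw [Finsupp.le_def, Fin.forall_fin_succ, Fin.forall_fin_succ, Fin.forall_fin_one]
  rfl

theorem expo_sub : expo i b g - expo i' b' g' = expo (i - i') (b - b') (g - g') := by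
  ext k
  fin_cases k <;> rfl

theorem expo_add : expo i b g + expo i' b' g' = expo (i + i') (b + b') (g + g') := by
  ext k
  fin_cases k <;> rfl

theorem nsmul_expo (n : ℕ) : n • expo i b g = expo (n * i) (n * b) (n * g) := by
  ext k
  fin_cases k <;> rfl

@[simp] theorem coeff_expo_seriesOf (f : ℕ → ℕ → ℕ → ℤ) :
    MvPowerSeries.coeff (expo i b g) (seriesOf f) = f i b g := rfl

theorem series_ext {F G : MvPowerSeries (Fin 3) ℤ}
    (h : ∀ i b g, MvPowerSeries.coeff (expo i b g) F = MvPowerSeries.coeff (expo i b g) G) :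
    F = G :=
  MvPowerSeries.ext fun d ↦ by rw [← expo_eta d, h]

theorem expo_ne_zero (h : 0 < b + g) : expo i b g ≠ 0 := fun h0 ↦ by
  have h1 := DFunLike.congr_fun h0 1
  have h2 := DFunLike.congr_fun h0 2
  rw [expo_one, Finsupp.zero_apply] at h1
  rw [expo_two, Finsupp.zero_apply] at h2
  omega

theorem coeff_expo_monomial_mul (F : MvPowerSeries (Fin 3) ℤ) :
    MvPowerSeries.coeff (expo i b g) (MvPowerSeries.monomial (expo i' b' g') 1 * F) =
      if i' ≤ i ∧ b' ≤ b ∧ g' ≤ g then MvPowerSeries.coeff (expo (i - i') (b - b') (g - g')) F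
      else 0 := by
  simp only [MvPowerSeries.coeff_monomial_mul, expo_le_iff, expo_sub, one_mul]

/-- Multiplication by a monomial times a Catalan series, on coefficients. -/
theorem coeff_expo_catalanAt_mul (k p q : ℕ) (hpq : 0 < p + q) (F : MvPowerSeries (Fin 3) ℤ) :
    MvPowerSeries.coeff (expo i b g)
        (MvPowerSeries.monomial (expo i' b' g') 1 * catalanAt (expo k p q) * F) =
      ∑ n ∈ Finset.range (b + g + 1),
        if i' + n * k ≤ i ∧ b' + n * p ≤ b ∧ g' + n * q ≤ g then
          (catalan n : ℤ) * MvPowerSeries.coeff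
            (expo (i - (i' + n * k)) (b - (b' + n * p)) (g - (g' + n * q))) F
        else 0 := by
  rw [coeff_monomial_mul_catalanAt_mul (N := b + g + 1) (expo_ne_zero hpq)]
  · simp only [nsmul_expo, expo_add, expo_le_iff, expo_sub]
  · intro n hn
    rw [nsmul_expo, expo_le_iff] at hn
    have : n * (p + q) ≤ b + g := by
      rw [mul_add]
      omega
    have := Nat.le_mul_of_pos_right n hpq
    omega

theorem expo_inj : expo i b g = expo i' b' g' ↔ i = i' ∧ b = b' ∧ g = g' := by
  rw [le_antisymm_iff, expo_le_iff, expo_le_iff]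
  omega

theorem coeff_expo_catalanAt_x (k : ℕ) :
    MvPowerSeries.coeff (expo i b g) (catalanAt (expo k 1 0)) =
      if i = b * k ∧ g = 0 then (catalan b : ℤ) else 0 := by
  rw [coeff_catalanAt (expo_ne_zero (by omega)) (N := b + 1)]
  · simp only [nsmul_expo, MvPowerSeries.coeff_monomial, expo_inj, mul_zero, mul_one]
    rw [Finset.sum_eq_single b]
    · simp
    · intro n _ hn
      exact if_neg fun h ↦ hn (by omega)
    · simp
  · intro n hn
    rw [nsmul_expo, expo_le_iff] at hn
    omega

theorem coeff_expo_catalanAt_y (k : ℕ) :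
    MvPowerSeries.coeff (expo i b g) (catalanAt (expo k 0 1)) =
      if i = g * k ∧ b = 0 then (catalan g : ℤ) else 0 := by
  rw [coeff_catalanAt (expo_ne_zero (by omega)) (N := g + 1)]
  · simp only [nsmul_expo, MvPowerSeries.coeff_monomial, expo_inj, mul_zero, mul_one]
    rw [Finset.sum_eq_single g]
    · simp
    · intro n _ hn
      exact if_neg fun h ↦ hn (by omega)
    · simp
  · intro n hn
    rw [nsmul_expo, expo_le_iff] at hn
    omega

/-- The coefficients of a product, as a triple sum. -/
theorem coeff_expo_mul (F G : MvPowerSeries (Fin 3) ℤ) :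
    MvPowerSeries.coeff (expo i b g) (F * G) =
      ∑ b' ∈ Finset.range (b + 1), ∑ g' ∈ Finset.range (g + 1), ∑ i' ∈ Finset.range (i + 1),
        MvPowerSeries.coeff (expo i' b' g') F *
          MvPowerSeries.coeff (expo (i - i') (b - b') (g - g')) G := by
  classical
  rw [MvPowerSeries.coeff_mul, ← Finset.sum_product', ← Finset.sum_product']
  refine Finset.sum_bij' (fun p _ ↦ ((p.1 1, p.1 2), p.1 0))
    (fun x _ ↦ (expo x.2 x.1.1 x.1.2, expo (i - x.2) (b - x.1.1) (g - x.1.2))) ?_ ?_ ?_ ?_ ?_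
  · intro p hp
    have hle : p.1 ≤ expo i b g := Finset.HasAntidiagonal.mem_antidiagonal.mp hp ▸ le_self_add
    rw [← expo_eta p.1, expo_le_iff] at hle
    simp only [Finset.mem_product, Finset.mem_range]
    omega
  · intro x hx
    simp only [Finset.mem_product, Finset.mem_range] at hx
    rw [Finset.HasAntidiagonal.mem_antidiagonal, expo_add]
    congr 1 <;> omega
  · intro p hp
    have h := Finset.HasAntidiagonal.mem_antidiagonal.mp hp
    have h2 : p.2 = expo i b g - p.1 := by rw [← h, add_tsub_cancel_left]
    refine Prod.ext (expo_eta _) ?_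
    dsimp only
    rw [h2, ← expo_sub, expo_eta]
  · intro x hx
    simp
  · intro p hp
    have h := Finset.HasAntidiagonal.mem_antidiagonal.mp hp
    have h2 : p.2 = expo i b g - p.1 := by rw [← h, add_tsub_cancel_left]
    dsimp only
    rw [h2, ← expo_sub, expo_eta]

end expo

/-! ### Recursions and functional equations -/

theorem dabNum_of_le_right {n j : ℕ} (i : ℕ) (h : n ≤ j) : dabNum n i j = 0 := by
  refine @Nat.card_of_isEmpty _ ⟨fun σ ↦ ?_⟩
  have h1 := (Equiv.Perm.lt_iff_lt_of_fix σ.1.2.fix i).mpr σ.2.1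
  rw [σ.2.2] at h1
  omega

/-- The recursion for an even value `2 * b`. The entries of `τᶜ` contribute the first sum and those
of `ρ` the second one; `b` and `g` change places in the first sum because of the complement. -/
theorem dabNum_even_rec (i b g : ℕ) :
    dabNum (2 * (b + g + 1)) i (2 * b) =
      (if i = 0 then catalan b * catalan g else 0) +
      (∑ n ∈ Finset.range (b + g + 1), if 1 ≤ i ∧ 1 + n ≤ b then
        catalan n * dabNum (2 * (b - (1 + n) + g + 1)) (i - 1) (2 * g) else 0) +
      ∑ n ∈ Finset.range (b + g + 1), if 2 + n * 2 ≤ i ∧ 1 + n ≤ g then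
        catalan n * dabNum (2 * (b + (g - (1 + n)) + 1)) (i - (2 + n * 2)) (2 * b) else 0 := by
  rw [dabNum_succ, Finset.sum_add_distrib, Finset.sum_add_distrib, Finset.sum_add_distrib]
  congr 1
  · rw [Finset.sum_eq_zero (f := fun x : ℕ × ℕ ↦ if i = 2 * x.1 + 1 ∧ _ then _ else _)
      fun x _ ↦ if_neg (by omega), add_zero]
    congr 1
    · rw [Finset.sum_eq_single (g, b)]
      · rw [mul_comm (catalan b)]
        exact if_congr (by simp) rfl rfl
      · intro x hx hne
        have hx' := Finset.HasAntidiagonal.mem_antidiagonal.mp hx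
        refine if_neg fun h ↦ hne (Prod.ext ?_ ?_) <;> dsimp only <;> omega
      · intro h
        exact absurd (Finset.HasAntidiagonal.mem_antidiagonal.mpr (by simp [add_comm])) h
    · rw [← Finset.Nat.sum_antidiagonal_swap, Finset.Nat.sum_antidiagonal_eq_sum_range_succ_mk]
      refine Finset.sum_congr rfl fun n hn ↦ ?_
      rw [Finset.mem_range] at hn
      dsimp only [Prod.swap]
      rcases Nat.lt_or_ge n b with h | h
      · refine if_congr (by omega) ?_ rfl
        rw [mul_comm]
        congr 2 <;> omega
      · rw [dabNum_of_le_right (n := 2 * (b + g - n)) _ (by omega), zero_mul, ite_self,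
          if_neg (by omega)]
  · rw [Finset.Nat.sum_antidiagonal_eq_sum_range_succ_mk]
    refine Finset.sum_congr rfl fun n hn ↦ ?_
    rw [Finset.mem_range] at hn
    dsimp only
    rcases Nat.lt_or_ge n g with h | h
    · refine if_congr (by omega) ?_ rfl
      congr 2 <;> omega
    · rw [dabNum_of_le_right (n := 2 * (b + g - n)) _ (by omega), mul_zero, ite_self,
        if_neg (by omega)]

/-- The recursion for an odd value `2 * b + 1`. The first sum stems from the second `1` of
`1 ⊕ τᶜ ⊕ 1`, which holds the maximal value. -/
theorem dabNum_odd_rec (i b g : ℕ) :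
    dabNum (2 * (b + g + 1)) i (2 * b + 1) =
      (∑ n ∈ Finset.range (b + g + 1), if i = 1 + n * 2 ∧ n ≤ b ∧ g = 0 then
        catalan n * catalan (b - n) else 0) +
      (∑ n ∈ Finset.range (b + g + 1), if 1 ≤ i ∧ n ≤ b ∧ 1 ≤ g then
        catalan n * dabNum (2 * (b - n + (g - 1) + 1)) (i - 1) (2 * (g - 1) + 1) else 0) +
      ∑ n ∈ Finset.range (b + g + 1), if 2 + n * 2 ≤ i ∧ 1 + n ≤ g then
        catalan n * dabNum (2 * (b + (g - (1 + n)) + 1)) (i - (2 + n * 2)) (2 * b + 1) else 0 := by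
  rw [dabNum_succ, Finset.sum_add_distrib, Finset.sum_add_distrib, Finset.sum_add_distrib]
  congr 1
  · rw [Finset.sum_eq_zero (f := fun x : ℕ × ℕ ↦ if i = 0 ∧ _ then _ else _)
      fun x _ ↦ if_neg (by omega), zero_add, add_comm]
    congr 1
    · rw [Finset.Nat.sum_antidiagonal_eq_sum_range_succ_mk]
      refine Finset.sum_congr rfl fun n hn ↦ ?_
      rw [Finset.mem_range] at hn
      dsimp only
      by_cases h : i = 1 + n * 2 ∧ n ≤ b ∧ g = 0
      · rw [if_pos h, if_pos (by omega), h.2.2, add_zero]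
      · rw [if_neg h, if_neg (by omega)]
    · rw [← Finset.Nat.sum_antidiagonal_swap, Finset.Nat.sum_antidiagonal_eq_sum_range_succ_mk]
      refine Finset.sum_congr rfl fun n hn ↦ ?_
      rw [Finset.mem_range] at hn
      dsimp only [Prod.swap]
      by_cases h : n ≤ b ∧ 1 ≤ g
      · refine if_congr (by omega) ?_ rfl
        rw [mul_comm]
        congr 2 <;> omega
      · rw [if_neg (c := 1 ≤ i ∧ n ≤ b ∧ 1 ≤ g) (by omega)]
        by_cases hg : 1 ≤ g
        · rw [dabNum_of_le_right (n := 2 * (b + g - n)) _ (by omega), zero_mul, ite_self]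
        · rw [if_neg (by omega)]
  · rw [Finset.Nat.sum_antidiagonal_eq_sum_range_succ_mk]
    refine Finset.sum_congr rfl fun n hn ↦ ?_
    rw [Finset.mem_range] at hn
    dsimp only
    rcases Nat.lt_or_ge n g with h | h
    · refine if_congr (by omega) ?_ rfl
      congr 2 <;> omega
    · rw [dabNum_of_le_right (n := 2 * (b + g - n)) _ (by omega), mul_zero, ite_self,
        if_neg (by omega)]

/-- The monomial `zⁱ xᵇ yᵍ`. -/
noncomputable abbrev mono (i b g : ℕ) : MvPowerSeries (Fin 3) ℤ :=
  MvPowerSeries.monomial (expo i b g) 1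

/-- The Catalan series evaluated at `zⁱ xᵇ yᵍ`. -/
noncomputable abbrev cat (i b g : ℕ) : MvPowerSeries (Fin 3) ℤ := catalanAt (expo i b g)

/-- The generating function of the entries with value `2 * b` (numbered from `0`). -/
noncomputable def evenSeries : MvPowerSeries (Fin 3) ℤ :=
  seriesOf fun i b g ↦ dabNum (2 * (b + g + 1)) i (2 * b)

/-- `evenSeries` with the roles of `x` and `y` exchanged. -/
noncomputable def evenSeriesSwap : MvPowerSeries (Fin 3) ℤ :=
  seriesOf fun i b g ↦ dabNum (2 * (b + g + 1)) i (2 * g)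

/-- The generating function of the entries with value `2 * b + 1` (numbered from `0`). -/
noncomputable def oddSeries : MvPowerSeries (Fin 3) ℤ :=
  seriesOf fun i b g ↦ dabNum (2 * (b + g + 1)) i (2 * b + 1)

/-- `oddSeries` with the roles of `x` and `y` exchanged. -/
noncomputable def oddSeriesSwap : MvPowerSeries (Fin 3) ℤ :=
  seriesOf fun i b g ↦ dabNum (2 * (b + g + 1)) i (2 * g + 1)

theorem mono_zero : mono 0 0 0 = 1 := by
  rw [← MvPowerSeries.monomial_zero_one]
  exact congrArg (fun e ↦ MvPowerSeries.monomial e (1 : ℤ)) (expo_eta 0)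

theorem cat_mul_cat : cat 0 1 0 * cat 0 0 1 =
    seriesOf fun i b g ↦ if i = 0 then (catalan b : ℤ) * catalan g else 0 := by
  refine series_ext fun i b g ↦ ?_
  rw [← one_mul (cat 0 1 0), ← mono_zero, coeff_expo_catalanAt_mul _ _ _ (by omega),
    coeff_expo_seriesOf, Finset.sum_eq_single b]
  · rw [if_pos (by omega), coeff_expo_catalanAt_y, mul_zero]
    by_cases h : i = 0 <;> simp [h]
  · intro n _ hn
    split_ifs with h
    · rw [coeff_expo_catalanAt_y, if_neg (by omega), mul_zero]
    · rfl
  · intro h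
    simp only [Finset.mem_range] at h
    omega

theorem evenSeries_eq : evenSeries = cat 0 1 0 * cat 0 0 1 +
    mono 1 1 0 * cat 0 1 0 * evenSeriesSwap + mono 2 0 1 * cat 2 0 1 * evenSeries := by
  refine series_ext fun i b g ↦ ?_
  rw [map_add, map_add, cat_mul_cat, coeff_expo_catalanAt_mul _ _ _ (by omega),
    coeff_expo_catalanAt_mul _ _ _ (by omega), evenSeries, evenSeriesSwap]
  simp only [coeff_expo_seriesOf]
  rw [dabNum_even_rec]
  push_cast
  congr 1
  · congr 1
    refine Finset.sum_congr rfl fun n _ ↦ ?_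
    simp only [mul_zero, mul_one, add_zero, tsub_zero, zero_le, and_true]
  · refine Finset.sum_congr rfl fun n _ ↦ ?_
    simp only [mul_zero, mul_one, add_zero, tsub_zero, zero_le, true_and]

theorem evenSeriesSwap_eq : evenSeriesSwap = cat 0 1 0 * cat 0 0 1 +
    mono 1 0 1 * cat 0 0 1 * evenSeries + mono 2 1 0 * cat 2 1 0 * evenSeriesSwap := by
  refine series_ext fun i b g ↦ ?_
  rw [map_add, map_add, cat_mul_cat, coeff_expo_catalanAt_mul _ _ _ (by omega),
    coeff_expo_catalanAt_mul _ _ _ (by omega), evenSeries, evenSeriesSwap]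
  simp only [coeff_expo_seriesOf]
  rw [add_comm b g, dabNum_even_rec]
  push_cast
  congr 1
  · congr 1
    · rw [mul_comm]
    · refine Finset.sum_congr rfl fun n _ ↦ ?_
      simp only [mul_zero, mul_one, add_zero, tsub_zero, zero_le, true_and, add_comm b]
  · refine Finset.sum_congr rfl fun n _ ↦ ?_
    simp only [mul_zero, mul_one, add_zero, tsub_zero, zero_le, and_true, add_comm g]

theorem oddSeries_eq : oddSeries = mono 1 0 0 * cat 2 1 0 * cat 0 1 0 +
    mono 1 0 1 * cat 0 1 0 * oddSeriesSwap + mono 2 0 1 * cat 2 0 1 * oddSeries := by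
  refine series_ext fun i b g ↦ ?_
  rw [map_add, map_add, coeff_expo_catalanAt_mul _ _ _ (by omega),
    coeff_expo_catalanAt_mul _ _ _ (by omega), coeff_expo_catalanAt_mul _ _ _ (by omega),
    oddSeries, oddSeriesSwap]
  simp only [coeff_expo_seriesOf, coeff_expo_catalanAt_x]
  rw [dabNum_odd_rec]
  push_cast
  congr 1
  · congr 1
    · refine Finset.sum_congr rfl fun n _ ↦ ?_
      simp only [mul_zero, mul_one, zero_add, tsub_zero]
      split_ifs <;> first | rfl | omega
    · refine Finset.sum_congr rfl fun n _ ↦ ?_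
      simp only [mul_zero, mul_one, add_zero, zero_add]
  · refine Finset.sum_congr rfl fun n _ ↦ ?_
    simp only [mul_zero, mul_one, add_zero, tsub_zero, zero_le, true_and]

theorem oddSeriesSwap_eq : oddSeriesSwap = mono 1 0 0 * cat 2 0 1 * cat 0 0 1 +
    mono 1 1 0 * cat 0 0 1 * oddSeries + mono 2 1 0 * cat 2 1 0 * oddSeriesSwap := by
  refine series_ext fun i b g ↦ ?_
  rw [map_add, map_add, coeff_expo_catalanAt_mul _ _ _ (by omega),
    coeff_expo_catalanAt_mul _ _ _ (by omega), coeff_expo_catalanAt_mul _ _ _ (by omega),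
    oddSeries, oddSeriesSwap]
  simp only [coeff_expo_seriesOf, coeff_expo_catalanAt_y]
  rw [add_comm b g, dabNum_odd_rec]
  push_cast
  congr 1
  · congr 1
    · refine Finset.sum_congr rfl fun n _ ↦ ?_
      simp only [mul_zero, mul_one, zero_add, tsub_zero]
      split_ifs <;> first | rfl | omega
    · refine Finset.sum_congr rfl fun n _ ↦ ?_
      simp only [mul_zero, mul_one, add_zero, zero_add, add_comm (b - 1), and_comm (a := 1 ≤ b)]
  · refine Finset.sum_congr rfl fun n _ ↦ ?_
    simp only [mul_zero, mul_one, add_zero, tsub_zero, zero_le, and_true, add_comm g]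

/-! ### Solution of the linear systems -/

section Algebra

variable {R : Type*} [CommRing R] {z U V X Y u v x y W T S P P' : R}

/-- The determinant of the linear systems for the generating functions has a multiple that
factors. The cofactor comes from the conjugate `(1 - X) (1 - Y) - z² (1 - U) V`, which arises from
the determinant by replacing `U` by `1 - U`, which leaves `U (1 - U)` unchanged. -/
theorem det_mul_eq (hX : X * (1 - X) = z ^ 2 * (U * (1 - U)))
    (hY : Y * (1 - Y) = z ^ 2 * (V * (1 - V))) :
    ((1 - X) * (1 - Y) - z ^ 2 * U * V) *
      ((1 - X) * (1 - Y) - z ^ 2 * (1 - X) * (1 - V) - z ^ 2 * (1 - U) * (V - Y)) =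
      (1 - X) * (1 - Y) * (1 - X - Y) * (1 - z ^ 2) := by
  linear_combination (-(z ^ 2 * V * (V - Y))) * hX + (X * (1 - X) - z ^ 2 * U * (1 - X)) * hY

/-- Cancelling the determinant: a solution of `det * P = r` is unique and explicit. -/
theorem eq_of_det_mul_eq [NoZeroDivisors R] {r : R} (hx : x * (1 - X) = 1) (hy : y * (1 - Y) = 1)
    (hX : X * (1 - X) = z ^ 2 * (U * (1 - U))) (hY : Y * (1 - Y) = z ^ 2 * (V * (1 - V)))
    (hW : W * (1 - X - Y) = 1) (hT : T * (1 - z ^ 2) = 1)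
    (hD : (1 - X) * (1 - Y) - z ^ 2 * U * V ≠ 0)
    (hP : ((1 - X) * (1 - Y) - z ^ 2 * U * V) * P = r) :
    P = r * ((1 - X) * (1 - Y) - z ^ 2 * (1 - X) * (1 - V) - z ^ 2 * (1 - U) * (V - Y)) *
      (x * y) * (W * T) := by
  refine mul_left_cancel₀ hD ?_
  have h1 : (x * (1 - X)) * (y * (1 - Y)) * (W * (1 - X - Y)) * (T * (1 - z ^ 2)) = 1 := by
    rw [hx, hy, hW, hT]
    ring
  have hH := det_mul_eq hX hY
  linear_combination hP - r * h1 - r * (x * y) * (W * T) * hH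

/-- Solution of the linear system for even values. With `β` and `γ` for the second and the third
variable of the power series, `u`, `v`, `x`, `y` are to be `c(β)`, `c(γ)`, `c(z² β)`, `c(z² γ)`.
The first remainder term contains neither `v` nor `V`, and the second one neither `u` nor `U`. This
is what confines the remainders to exponents outside the range of the theorem. -/
theorem even_solution [NoZeroDivisors R] (hu : u * (1 - U) = 1) (hv : v * (1 - V) = 1)
    (hx : x * (1 - X) = 1)
    (hy : y * (1 - Y) = 1) (hX : X * (1 - X) = z ^ 2 * (U * (1 - U)))
    (hY : Y * (1 - Y) = z ^ 2 * (V * (1 - V))) (hW : W * (1 - X - Y) = 1)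
    (hT : T * (1 - z ^ 2) = 1) (hS : (1 - z) * S = u * v)
    (hD : (1 - X) * (1 - Y) - z ^ 2 * U * V ≠ 0)
    (hP : P = u * v + z * U * P' + Y * P) (hP' : P' = u * v + z * V * P + X * P') :
    P = S * (1 + Y * W) +
      (T * W * u * (z * (X - z ^ 2 * U) * y - (1 - X) * z ^ 2 * y) +
      T * W * (-((1 - X) * z ^ 2 * x * v * (V - Y) * y) - z * v)) := by
  have hdet : ((1 - X) * (1 - Y) - z ^ 2 * U * V) * P = u * v * (1 - X + z * U) := by
    linear_combination (1 - X) * hP + z * U * hP'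
  rw [eq_of_det_mul_eq hx hy hX hY hW hT hD hdet]
  have hS' : S = (1 + z) * (u * v) * T := by linear_combination (-S) * hT + (1 + z) * T * hS
  have hW' : 1 + Y * W = W * (1 - X) := by linear_combination -hW
  -- Every term is written as a polynomial multiple of the unit `u v x y`.
  have e1 : u * v = u * v * (x * y) * ((1 - X) * (1 - Y)) := by
    linear_combination (-(u * v * (y * (1 - Y)))) * hx - u * v * hy
  have e2 : u * y = u * v * (x * y) * ((1 - V) * (1 - X)) := by
    linear_combination (-(u * y * (x * (1 - X)))) * hv - u * y * hx
  have e3 : x * v * y = u * v * (x * y) * (1 - U) := by linear_combination (-(x * v * y)) * hu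
  have e4 : v = u * v * (x * y) * ((1 - U) * (1 - X) * (1 - Y)) := by
    linear_combination (-(v * (x * (1 - X)) * (y * (1 - Y)))) * hu - v * (y * (1 - Y)) * hx - v * hy
  rw [hS', hW']
  linear_combination T * W * (z * (V - Y) * (u * v * (x * y)) * hX - (1 + z) * (1 - X) * e1 -
    (z * (X - z ^ 2 * U) - (1 - X) * z ^ 2) * e2 + (1 - X) * z ^ 2 * (V - Y) * e3 + z * e4)

/-- Solution of the linear system for odd values, with remainder terms of the same kind as in
`even_solution`; `β` and `γ` are to be the second and the
third variable of the power series. -/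
theorem odd_solution [NoZeroDivisors R] {β γ : R} (hU : U = β * u) (hV : V = γ * v) (hu : u * (1 - U) = 1)
    (hv : v * (1 - V) = 1) (hx : x * (1 - X) = 1)
    (hy : y * (1 - Y) = 1) (hX : X * (1 - X) = z ^ 2 * (U * (1 - U)))
    (hY : Y * (1 - Y) = z ^ 2 * (V * (1 - V))) (hW : W * (1 - X - Y) = 1)
    (hT : T * (1 - z ^ 2) = 1) (hS : (1 - z) * S = u * v)
    (hD : (1 - X) * (1 - Y) - z ^ 2 * U * V ≠ 0)
    (hP : P = z * x * u + z * γ * u * P' + Y * P)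
    (hP' : P' = z * y * v + z * β * v * P + X * P') :
    P = S * (Y * W) +
      (T * W * u * (z * (1 - z ^ 2 * y) - z ^ 2 * Y * y) +
      T * W * z ^ 2 * (z * (x * (1 - V) * y - x) - Y * x * v * (V - Y) * y)) := by
  have e5 : z ^ 2 * V * y = Y * v := by
    linear_combination (-(z ^ 2 * V * y)) * hv - v * y * hY + Y * v * hy
  have e0 : u = u * v * (1 - V) := by linear_combination -u * hv
  have hdet : ((1 - X) * (1 - Y) - z ^ 2 * U * V) * P = u * v * (z * (1 - V) + Y) := by
    rw [hU, hV] at *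
    linear_combination (1 - X) * hP + z * γ * u * hP' + z * u * hx + z * e0 + u * e5
  rw [eq_of_det_mul_eq hx hy hX hY hW hT hD hdet]
  have hS' : S = (1 + z) * (u * v) * T := by linear_combination (-S) * hT + (1 + z) * T * hS
  -- Every term is written as a polynomial multiple of the unit `u v x y`.
  have e1 : u * v = u * v * (x * y) * ((1 - X) * (1 - Y)) := by
    linear_combination (-(u * v * (y * (1 - Y)))) * hx - u * v * hy
  have e2 : u * y = u * v * (x * y) * ((1 - V) * (1 - X)) := by
    linear_combination (-(u * y * (x * (1 - X)))) * hv - u * y * hx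
  have e3 : x * v * y = u * v * (x * y) * (1 - U) := by linear_combination (-(x * v * y)) * hu
  have e4 : x * y = u * v * (x * y) * ((1 - U) * (1 - V)) := by
    linear_combination (-(x * y * (v * (1 - V)))) * hu - x * y * hv
  have e6 : x = u * v * (x * y) * ((1 - U) * (1 - V) * (1 - Y)) := by
    linear_combination (-(x * (v * (1 - V)) * (y * (1 - Y)))) * hu - x * (y * (1 - Y)) * hv - x * hy
  have e7 : u = u * v * (x * y) * ((1 - V) * (1 - X) * (1 - Y)) := by
    linear_combination (-(u * (x * (1 - X)) * (y * (1 - Y)))) * hv - u * (y * (1 - Y)) * hx - u * hy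
  rw [hS']
  linear_combination T * W * (-(z * (1 - X) * (u * v * (x * y)) * hY) - (1 + z) * Y * e1 +
    (z ^ 3 + z ^ 2 * Y) * e2 - z * e7 + z ^ 2 * Y * (V - Y) * e3 - z ^ 3 * (1 - V) * e4 +
    z ^ 3 * e6)

end Algebra

/-! ### Support of the remainders and the ballot series -/

/-- Power series all of whose monomials `zⁱ xᵇ yᵍ` satisfy `i ≥ 2 e + k`, where `e` is the exponent
of the variable `v`. -/
def highIn (v : Fin 3) (k : ℕ) : AddSubgroup (MvPowerSeries (Fin 3) ℤ) where
  carrier := {F | ∀ d, MvPowerSeries.coeff d F ≠ 0 → 2 * d v + k ≤ d 0}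
  zero_mem' d h := absurd (MvPowerSeries.coeff_zero d) h
  add_mem' {F G} hF hG d h := by
    rw [map_add] at h
    by_cases h1 : MvPowerSeries.coeff d F = 0
    · exact hG d (by rwa [h1, zero_add] at h)
    · exact hF d h1
  neg_mem' {F} hF d h := hF d (by rwa [map_neg, neg_ne_zero] at h)

section highIn

variable {v : Fin 3} {k l : ℕ} {F G : MvPowerSeries (Fin 3) ℤ}

theorem highIn_mul (hF : F ∈ highIn v k) (hG : G ∈ highIn v l) : F * G ∈ highIn v (k + l) := by
  classical
  intro d h
  rw [MvPowerSeries.coeff_mul] at h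
  obtain ⟨p, hp, hne⟩ := Finset.exists_ne_zero_of_sum_ne_zero h
  have h1 := hF p.1 (left_ne_zero_of_mul hne)
  have h2 := hG p.2 (right_ne_zero_of_mul hne)
  rw [← Finset.HasAntidiagonal.mem_antidiagonal.mp hp, Finsupp.add_apply, Finsupp.add_apply]
  omega

theorem highIn_zero_mul (hF : F ∈ highIn v 0) (hG : G ∈ highIn v k) : F * G ∈ highIn v k := by
  simpa using highIn_mul hF hG

theorem highIn_mul_zero (hF : F ∈ highIn v k) (hG : G ∈ highIn v 0) : F * G ∈ highIn v k :=
  highIn_mul hF hG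

theorem highIn_anti (h : l ≤ k) (hF : F ∈ highIn v k) : F ∈ highIn v l :=
  fun d hd ↦ (Nat.add_le_add_left h _).trans (hF d hd)

theorem monomial_mem_highIn {e : Fin 3 →₀ ℕ} (h : 2 * e v + k ≤ e 0) (c : ℤ) :
    MvPowerSeries.monomial e c ∈ highIn v k := by
  intro d hd
  rwa [MvPowerSeries.eq_of_coeff_monomial_ne_zero hd]

theorem one_mem_highIn : (1 : MvPowerSeries (Fin 3) ℤ) ∈ highIn v 0 :=
  MvPowerSeries.monomial_zero_one (σ := Fin 3) (R := ℤ) ▸ monomial_mem_highIn (by simp) 1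

theorem catalanAt_mem_highIn {e : Fin 3 →₀ ℕ} (he : e ≠ 0) (h : 2 * e v ≤ e 0) :
    catalanAt e ∈ highIn v 0 := by
  obtain ⟨j, hj⟩ : ∃ j, e j ≠ 0 := by
    by_contra! hc
    exact he (Finsupp.ext hc)
  intro d hd
  rw [coeff_catalanAt he (N := d j + 1)] at hd
  · obtain ⟨n, -, hn⟩ := Finset.exists_ne_zero_of_sum_ne_zero hd
    rw [MvPowerSeries.eq_of_coeff_monomial_ne_zero hn, Finsupp.smul_apply, Finsupp.smul_apply,
      smul_eq_mul, smul_eq_mul]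
    have := Nat.mul_le_mul_left n h
    linarith
  · intro n hn
    have h1 := hn j
    rw [Finsupp.smul_apply, smul_eq_mul] at h1
    have := Nat.le_mul_of_pos_right n (Nat.pos_of_ne_zero hj)
    omega

theorem coeff_eq_zero_of_mem_highIn {d : Fin 3 →₀ ℕ} (hF : F ∈ highIn v k)
    (h : d 0 < 2 * d v + k) : MvPowerSeries.coeff d F = 0 := by
  by_contra hne
  exact absurd (hF d hne) (by omega)

end highIn

/-- The series `1 / (1 - X - Y) = ∑ C_{b+g} (z² x)ᵇ (z² y)ᵍ`, where `X = z² x c(z² x)` and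
`Y = z² y c(z² y)`. -/
noncomputable def ballotSeries : MvPowerSeries (Fin 3) ℤ :=
  seriesOf fun i b g ↦ if i = 2 * (b + g) then (catalan (b + g) : ℤ) else 0

/-- The series `1 / (1 - z²)`. -/
noncomputable def geomSeries : MvPowerSeries (Fin 3) ℤ :=
  seriesOf fun i b g ↦ if i % 2 = 0 ∧ b = 0 ∧ g = 0 then 1 else 0

/-- The series `c(x) c(y) / (1 - z)`. -/
noncomputable def catalanProductSeries : MvPowerSeries (Fin 3) ℤ :=
  seriesOf fun _ b g ↦ (catalan b : ℤ) * catalan g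

theorem cat_mul_one_sub {i b g : ℕ} (h : 0 < b + g) :
    cat i b g * (1 - mono i b g * cat i b g) = 1 := by
  have := catalanAt_eq (expo_ne_zero (i := i) h)
  linear_combination this

theorem mono_mul_cat_mul_one_sub {i b g : ℕ} (h : 0 < b + g) :
    mono i b g * cat i b g * (1 - mono i b g * cat i b g) = mono i b g := by
  rw [mul_assoc, cat_mul_one_sub h, mul_one]

theorem mono_mul_mono (i b g i' b' g' : ℕ) :
    mono i b g * mono i' b' g' = mono (i + i') (b + b') (g + g') := by
  rw [MvPowerSeries.monomial_mul_monomial, expo_add, mul_one]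

/-- Multiplying `∑ C_{b+g} pᵇ qᵍ` by `p - q`, with `p = z² x` and `q = z² y`, telescopes to `X - Y`,
and `(X - Y) (1 - X - Y) = p - q`. -/
theorem ballotSeries_mul : ballotSeries *
    (1 - mono 2 1 0 * cat 2 1 0 - mono 2 0 1 * cat 2 0 1) = 1 := by
  have hX := mono_mul_cat_mul_one_sub (i := 2) (b := 1) (g := 0) (by omega)
  have hY := mono_mul_cat_mul_one_sub (i := 2) (b := 0) (g := 1) (by omega)
  have h1 : mono 2 1 0 * ballotSeries + mono 2 0 1 * cat 2 0 1 =
      mono 2 0 1 * ballotSeries + mono 2 1 0 * cat 2 1 0 := by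
    refine series_ext fun i b g ↦ ?_
    rw [map_add, map_add]
    simp only [coeff_expo_monomial_mul, ballotSeries, coeff_expo_seriesOf, coeff_expo_catalanAt_x,
      coeff_expo_catalanAt_y]
    rcases b with _ | b <;> rcases g with _ | g
    · simp
    · by_cases hi : i = 2 * (g + 1)
      · subst hi
        simp [mul_comm]
      · simp only [Nat.add_sub_cancel]
        split_ifs <;> first | rfl | omega
    · by_cases hi : i = 2 * (b + 1)
      · subst hi
        simp [mul_comm]
      · simp only [Nat.add_sub_cancel]
        split_ifs <;> first | rfl | omega
    · simp only [Nat.add_sub_cancel, tsub_zero, Nat.add_one_ne_zero, and_false, if_false, ite_self]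
      rw [show b + (g + 1) = b + 1 + g by ring]
      split_ifs <;> first | rfl | omega
  have hne : mono 2 1 0 - mono 2 0 1 ≠ 0 := by
    intro h
    have := congrArg (MvPowerSeries.coeff (expo 2 1 0)) h
    rw [map_sub, MvPowerSeries.coeff_monomial_same, MvPowerSeries.coeff_monomial_ne, map_zero]
      at this
    · norm_num at this
    · rw [Ne, expo_inj]
      omega
  refine mul_left_cancel₀ hne ?_
  linear_combination (1 - mono 2 1 0 * cat 2 1 0 - mono 2 0 1 * cat 2 0 1) * h1 + hX - hY

theorem geomSeries_mul : geomSeries * (1 - mono 1 0 0 ^ 2) = 1 := by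
  have h : mono 1 0 0 ^ 2 = mono 2 0 0 := by rw [sq, mono_mul_mono]
  have h1 : geomSeries = 1 + mono 2 0 0 * geomSeries := by
    rw [← mono_zero]
    refine series_ext fun i b g ↦ ?_
    rw [map_add]
    simp only [coeff_expo_monomial_mul, geomSeries, coeff_expo_seriesOf,
      MvPowerSeries.coeff_monomial, expo_inj]
    split_ifs <;> first | rfl | omega
  rw [h]
  linear_combination h1

theorem one_sub_mul_catalanProductSeries :
    (1 - mono 1 0 0) * catalanProductSeries = cat 0 1 0 * cat 0 0 1 := by
  have h1 : catalanProductSeries =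
      cat 0 1 0 * cat 0 0 1 + mono 1 0 0 * catalanProductSeries := by
    rw [cat_mul_cat]
    refine series_ext fun i b g ↦ ?_
    rw [map_add]
    simp only [coeff_expo_monomial_mul, catalanProductSeries, coeff_expo_seriesOf, tsub_zero]
    rcases i with _ | i <;> simp
  linear_combination h1

/-- The numbers `p_{r,s}` are the coefficients of `Y / (1 - X - Y)`. -/
theorem coeff_mono_mul_cat_mul_ballotSeries (i b g : ℕ) :
    MvPowerSeries.coeff (expo i b g) (mono 2 0 1 * cat 2 0 1 * ballotSeries) =
      if i = 2 * (b + g) ∧ 1 ≤ g then (dyckFirstReturnCount (b + 1) g : ℤ) else 0 := by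
  rw [coeff_expo_catalanAt_mul _ _ _ (by omega)]
  simp only [ballotSeries, coeff_expo_seriesOf]
  split_ifs with h
  · rw [dyckFirstReturnCount_eq_sum (by omega) h.2, Nat.cast_sum]
    symm
    refine Finset.sum_bij_ne_zero (fun k _ _ ↦ k - 1) ?_ ?_ ?_ ?_
    · intro k hk _
      simp only [Finset.mem_Icc, Finset.mem_range] at hk ⊢
      omega
    · intro k hk _ k' hk' _ he
      simp only [Finset.mem_Icc] at hk hk'
      omega
    · intro n _ hne
      have hc := (ite_ne_right_iff.mp hne).1
      refine ⟨n + 1, Finset.mem_Icc.mpr (by omega), ?_, rfl⟩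
      rw [if_pos hc, if_pos (by omega)] at hne
      rw [Nat.add_sub_cancel]
      convert hne using 1
      rw [Nat.cast_mul, mul_comm]
      congr 3
      omega
    · intro k hk _
      simp only [Finset.mem_Icc] at hk
      rw [if_pos (by omega), if_pos (by omega), Nat.cast_mul, mul_comm]
      congr 3
      omega
  · refine Finset.sum_eq_zero fun n _ ↦ ?_
    split_ifs
    · omega
    · rw [mul_zero]
    · rfl

/-! ### Extraction of coefficients -/

/-- The coefficients of `c(x) c(y) / (1 - z) · Y / (1 - X - Y)` are the double sums of the theorem.
The bounds on `i` ensure that no truncated subtraction occurs in the double sum. -/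
theorem coeff_catalanProductSeries_mul (i b g : ℕ) (hb : i ≤ 2 * b + 1) (hg : i ≤ 2 * g + 1) :
    MvPowerSeries.coeff (expo i b g)
      (catalanProductSeries * (mono 2 0 1 * cat 2 0 1 * ballotSeries)) =
      ∑ r ∈ Finset.Icc 1 (i / 2), ∑ s ∈ Finset.Icc 1 (i / 2 + 1 - r),
        (dyckFirstReturnCount r s : ℤ) * catalan (b + 1 - r) * catalan (g - s) := by
  rw [mul_comm, coeff_expo_mul]
  simp only [coeff_mono_mul_cat_mul_ballotSeries, catalanProductSeries, coeff_expo_seriesOf]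
  have h1 : ∀ b' g' : ℕ, ∑ i' ∈ Finset.range (i + 1),
      (if i' = 2 * (b' + g') ∧ 1 ≤ g' then (dyckFirstReturnCount (b' + 1) g' : ℤ) else 0) *
        (catalan (b - b') * catalan (g - g')) =
      if 2 * (b' + g') ≤ i ∧ 1 ≤ g' then
        (dyckFirstReturnCount (b' + 1) g' : ℤ) * (catalan (b - b') * catalan (g - g')) else 0 := by
    intro b' g'
    by_cases h : 2 * (b' + g') ≤ i ∧ 1 ≤ g'
    · rw [if_pos h, Finset.sum_eq_single (2 * (b' + g')), if_pos ⟨rfl, h.2⟩]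
      · intro i' _ hne
        rw [if_neg (by omega), zero_mul]
      · intro hn
        simp only [Finset.mem_range] at hn
        omega
    · rw [if_neg h]
      refine Finset.sum_eq_zero fun i' hi' ↦ ?_
      rw [Finset.mem_range] at hi'
      rw [if_neg (by omega), zero_mul]
  simp only [h1]
  rw [Finset.sum_sigma', Finset.sum_sigma', ← Finset.sum_filter]
  refine Finset.sum_bij' (fun x _ ↦ ⟨x.1 + 1, x.2⟩) (fun x _ ↦ ⟨x.1 - 1, x.2⟩) ?_ ?_ ?_ ?_ ?_
  · rintro ⟨b', g'⟩ hx
    simp only [Finset.mem_filter, Finset.mem_sigma, Finset.mem_range, Finset.mem_Icc] at hx ⊢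
    omega
  · rintro ⟨r, s⟩ hx
    simp only [Finset.mem_filter, Finset.mem_sigma, Finset.mem_range, Finset.mem_Icc] at hx ⊢
    omega
  · rintro ⟨b', g'⟩ _
    rfl
  · rintro ⟨r, s⟩ hx
    simp only [Finset.mem_sigma, Finset.mem_Icc] at hx
    dsimp only
    rw [Nat.sub_add_cancel hx.1.1]
  · rintro ⟨b', g'⟩ _
    dsimp only
    rw [Nat.add_sub_add_right, mul_assoc]

theorem geomSeries_mem_highIn (v : Fin 3) (hv : v ≠ 0) : geomSeries ∈ highIn v 0 := by
  intro d h
  rw [← expo_eta d, geomSeries, coeff_expo_seriesOf, ite_ne_right_iff] at h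
  fin_cases v
  · exact absurd rfl hv
  · change 2 * d 1 + 0 ≤ d 0
    omega
  · change 2 * d 2 + 0 ≤ d 0
    omega

theorem ballotSeries_mem_highIn (v : Fin 3) (hv : v ≠ 0) : ballotSeries ∈ highIn v 0 := by
  intro d h
  rw [← expo_eta d, ballotSeries, coeff_expo_seriesOf, ite_ne_right_iff] at h
  fin_cases v
  · exact absurd rfl hv
  · change 2 * d 1 + 0 ≤ d 0
    omega
  · change 2 * d 2 + 0 ≤ d 0
    omega

theorem mono_mem_highIn {v : Fin 3} {k i b g : ℕ} (h : 2 * expo i b g v + k ≤ i) :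
    mono i b g ∈ highIn v k := monomial_mem_highIn h 1

theorem cat_mem_highIn {v : Fin 3} {i b g : ℕ} (hne : 0 < b + g) (h : 2 * expo i b g v ≤ i) :
    cat i b g ∈ highIn v 0 := catalanAt_mem_highIn (expo_ne_zero hne) h

theorem mono_mul_cat_mem_highIn {v : Fin 3} {i b g : ℕ} (hne : 0 < b + g)
    (h : 2 * expo i b g v ≤ i) : mono i b g * cat i b g ∈ highIn v 0 :=
  highIn_zero_mul (mono_mem_highIn h) (cat_mem_highIn hne h)

/-- The determinant has constant coefficient `1`. -/
theorem det_ne_zero : (1 - mono 2 1 0 * cat 2 1 0) * (1 - mono 2 0 1 * cat 2 0 1) -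
    mono 1 0 0 ^ 2 * (mono 0 1 0 * cat 0 1 0) * (mono 0 0 1 * cat 0 0 1) ≠ 0 := by
  intro h
  have hc : ∀ i b g : ℕ, 0 < i + b + g →
      MvPowerSeries.constantCoeff (R := ℤ) (mono i b g) = 0 := fun i b g hpos ↦ by
    rw [← MvPowerSeries.coeff_zero_eq_constantCoeff_apply]
    refine MvPowerSeries.coeff_monomial_ne (fun h0 ↦ ?_) 1
    rw [← expo_eta 0, expo_inj] at h0
    simp only [Finsupp.zero_apply] at h0
    omega
  have := congrArg (MvPowerSeries.constantCoeff (R := ℤ)) h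
  simp only [map_sub, map_mul, map_one, map_pow, map_zero] at this
  rw [hc 2 1 0 (by omega), hc 2 0 1 (by omega), hc 1 0 0 (by omega)] at this
  norm_num at this

theorem mono_two_mul_cat_mul_one_sub (b g : ℕ) (h : 0 < b + g) :
    mono 2 b g * cat 2 b g * (1 - mono 2 b g * cat 2 b g) =
      mono 1 0 0 ^ 2 * (mono 0 b g * cat 0 b g * (1 - mono 0 b g * cat 0 b g)) := by
  rw [mono_mul_cat_mul_one_sub h, mono_mul_cat_mul_one_sub h, sq, mono_mul_mono, mono_mul_mono]
  congr 2 <;> ring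

/-- Up to monomials with `i ≥ 2 g + 1` or `i ≥ 2 b + 1`, the generating function for even values is
`c(x) c(y) / (1 - z) · (1 + Y / (1 - X - Y))`. -/
theorem evenSeries_decomposition : ∃ F ∈ highIn 2 1, ∃ G ∈ highIn 1 1,
    evenSeries = catalanProductSeries * (1 + mono 2 0 1 * cat 2 0 1 * ballotSeries) +
      (F + G) := by
  have hP : evenSeries = cat 0 1 0 * cat 0 0 1 +
      mono 1 0 0 * (mono 0 1 0 * cat 0 1 0) * evenSeriesSwap +
      mono 2 0 1 * cat 2 0 1 * evenSeries := by
    rw [← mul_assoc (mono 1 0 0), mono_mul_mono]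
    exact evenSeries_eq
  have hP' : evenSeriesSwap = cat 0 1 0 * cat 0 0 1 +
      mono 1 0 0 * (mono 0 0 1 * cat 0 0 1) * evenSeries +
      mono 2 1 0 * cat 2 1 0 * evenSeriesSwap := by
    rw [← mul_assoc (mono 1 0 0), mono_mul_mono]
    exact evenSeriesSwap_eq
  refine ⟨_, ?_, _, ?_, even_solution (cat_mul_one_sub (by omega)) (cat_mul_one_sub (by omega))
    (cat_mul_one_sub (by omega)) (cat_mul_one_sub (by omega))
    (mono_two_mul_cat_mul_one_sub 1 0 (by omega)) (mono_two_mul_cat_mul_one_sub 0 1 (by omega))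
    ballotSeries_mul geomSeries_mul one_sub_mul_catalanProductSeries det_ne_zero hP hP'⟩
  · have hT := geomSeries_mem_highIn 2 (by decide)
    have hW := ballotSeries_mem_highIn 2 (by decide)
    have hz : mono 1 0 0 ∈ highIn 2 1 := mono_mem_highIn (by simp)
    have hz2 : mono 1 0 0 ^ 2 ∈ highIn 2 1 := by
      rw [sq, mono_mul_mono]
      exact mono_mem_highIn (by simp)
    have hu : cat 0 1 0 ∈ highIn 2 0 := cat_mem_highIn (by omega) (by simp)
    have hy : cat 2 0 1 ∈ highIn 2 0 := cat_mem_highIn (by omega) (by simp)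
    have hX : mono 2 1 0 * cat 2 1 0 ∈ highIn 2 0 := mono_mul_cat_mem_highIn (by omega) (by simp)
    have hU : mono 0 1 0 * cat 0 1 0 ∈ highIn 2 0 := mono_mul_cat_mem_highIn (by omega) (by simp)
    refine highIn_zero_mul (highIn_zero_mul (highIn_zero_mul hT hW) hu) (sub_mem ?_ ?_)
    · exact highIn_mul_zero (highIn_mul_zero hz (sub_mem hX
        (highIn_zero_mul (highIn_anti zero_le_one hz2) hU))) hy
    · exact highIn_mul_zero (highIn_zero_mul (sub_mem one_mem_highIn hX) hz2) hy
  · have hT := geomSeries_mem_highIn 1 (by decide)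
    have hW := ballotSeries_mem_highIn 1 (by decide)
    have hz : mono 1 0 0 ∈ highIn 1 1 := mono_mem_highIn (by simp)
    have hz2 : mono 1 0 0 ^ 2 ∈ highIn 1 1 := by
      rw [sq, mono_mul_mono]
      exact mono_mem_highIn (by simp)
    have hv : cat 0 0 1 ∈ highIn 1 0 := cat_mem_highIn (by omega) (by simp)
    have hx : cat 2 1 0 ∈ highIn 1 0 := cat_mem_highIn (by omega) (by simp)
    have hy : cat 2 0 1 ∈ highIn 1 0 := cat_mem_highIn (by omega) (by simp)
    have hX : mono 2 1 0 * cat 2 1 0 ∈ highIn 1 0 := mono_mul_cat_mem_highIn (by omega) (by simp)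
    have hY : mono 2 0 1 * cat 2 0 1 ∈ highIn 1 0 := mono_mul_cat_mem_highIn (by omega) (by simp)
    have hV : mono 0 0 1 * cat 0 0 1 ∈ highIn 1 0 := mono_mul_cat_mem_highIn (by omega) (by simp)
    refine highIn_zero_mul (highIn_zero_mul hT hW) (sub_mem (neg_mem ?_) (highIn_mul_zero hz hv))
    exact highIn_mul_zero (highIn_mul_zero (highIn_mul_zero (highIn_mul_zero (highIn_zero_mul
      (sub_mem one_mem_highIn hX) hz2) hx) hv) (sub_mem hV hY)) hy

/-- Up to monomials with `i ≥ 2 g` or `i ≥ 2 b + 2`, the generating function for odd values is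
`c(x) c(y) / (1 - z) · Y / (1 - X - Y)`. -/
theorem oddSeries_decomposition : ∃ F ∈ highIn 2 0, ∃ G ∈ highIn 1 2,
    oddSeries = catalanProductSeries * (mono 2 0 1 * cat 2 0 1 * ballotSeries) + (F + G) := by
  have hP : oddSeries = mono 1 0 0 * cat 2 1 0 * cat 0 1 0 +
      mono 1 0 0 * mono 0 0 1 * cat 0 1 0 * oddSeriesSwap +
      mono 2 0 1 * cat 2 0 1 * oddSeries := by
    rw [mono_mul_mono]
    exact oddSeries_eq
  have hP' : oddSeriesSwap = mono 1 0 0 * cat 2 0 1 * cat 0 0 1 +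
      mono 1 0 0 * mono 0 1 0 * cat 0 0 1 * oddSeries +
      mono 2 1 0 * cat 2 1 0 * oddSeriesSwap := by
    rw [mono_mul_mono]
    exact oddSeriesSwap_eq
  refine ⟨_, ?_, _, ?_, odd_solution rfl rfl (cat_mul_one_sub (by omega))
    (cat_mul_one_sub (by omega)) (cat_mul_one_sub (by omega)) (cat_mul_one_sub (by omega))
    (mono_two_mul_cat_mul_one_sub 1 0 (by omega)) (mono_two_mul_cat_mul_one_sub 0 1 (by omega))
    ballotSeries_mul geomSeries_mul one_sub_mul_catalanProductSeries det_ne_zero hP hP'⟩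
  · have hT := geomSeries_mem_highIn 2 (by decide)
    have hW := ballotSeries_mem_highIn 2 (by decide)
    have hz : mono 1 0 0 ∈ highIn 2 0 := mono_mem_highIn (by simp)
    have hz2 : mono 1 0 0 ^ 2 ∈ highIn 2 0 := by
      rw [sq, mono_mul_mono]
      exact mono_mem_highIn (by simp)
    have hu : cat 0 1 0 ∈ highIn 2 0 := cat_mem_highIn (by omega) (by simp)
    have hy : cat 2 0 1 ∈ highIn 2 0 := cat_mem_highIn (by omega) (by simp)
    have hY : mono 2 0 1 * cat 2 0 1 ∈ highIn 2 0 := mono_mul_cat_mem_highIn (by omega) (by simp)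
    refine highIn_zero_mul (highIn_zero_mul (highIn_zero_mul hT hW) hu) (sub_mem ?_ ?_)
    · exact highIn_zero_mul hz (sub_mem one_mem_highIn (highIn_zero_mul hz2 hy))
    · exact highIn_mul_zero (highIn_mul_zero hz2 hY) hy
  · have hT := geomSeries_mem_highIn 1 (by decide)
    have hW := ballotSeries_mem_highIn 1 (by decide)
    have hz : mono 1 0 0 ∈ highIn 1 0 := mono_mem_highIn (by simp)
    have hz2 : mono 1 0 0 ^ 2 ∈ highIn 1 2 := by
      rw [sq, mono_mul_mono]
      exact mono_mem_highIn (by simp)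
    have hv : cat 0 0 1 ∈ highIn 1 0 := cat_mem_highIn (by omega) (by simp)
    have hx : cat 2 1 0 ∈ highIn 1 0 := cat_mem_highIn (by omega) (by simp)
    have hy : cat 2 0 1 ∈ highIn 1 0 := cat_mem_highIn (by omega) (by simp)
    have hY : mono 2 0 1 * cat 2 0 1 ∈ highIn 1 0 := mono_mul_cat_mem_highIn (by omega) (by simp)
    have hV : mono 0 0 1 * cat 0 0 1 ∈ highIn 1 0 := mono_mul_cat_mem_highIn (by omega) (by simp)
    refine highIn_mul_zero (highIn_zero_mul (highIn_zero_mul hT hW) hz2) (sub_mem ?_ ?_)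
    · exact highIn_zero_mul hz (sub_mem (highIn_zero_mul (highIn_zero_mul hx
        (sub_mem one_mem_highIn hV)) hy) hx)
    · exact highIn_zero_mul (highIn_zero_mul (highIn_zero_mul (highIn_zero_mul hY hx) hv)
        (sub_mem hV hY)) hy

theorem dabNum_even_eq (i b g : ℕ) (hb : i ≤ 2 * b) (hg : i ≤ 2 * g) :
    dabNum (2 * (b + g + 1)) i (2 * b) = catalan b * catalan g +
      ∑ r ∈ Finset.Icc 1 (i / 2), ∑ s ∈ Finset.Icc 1 (i / 2 + 1 - r),
        dyckFirstReturnCount r s * catalan (b + 1 - r) * catalan (g - s) := by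
  obtain ⟨F, hF, G, hG, h⟩ := evenSeries_decomposition
  have h1 := congrArg (MvPowerSeries.coeff (expo i b g)) h
  rw [map_add, map_add, coeff_eq_zero_of_mem_highIn hF (by simp; omega),
    coeff_eq_zero_of_mem_highIn hG (by simp; omega), mul_one_add, map_add,
    coeff_catalanProductSeries_mul i b g (by omega) (by omega), add_zero, add_zero, evenSeries,
    catalanProductSeries, coeff_expo_seriesOf, coeff_expo_seriesOf] at h1
  exact_mod_cast h1

theorem dabNum_odd_eq (i b g : ℕ) (hb : i ≤ 2 * b + 1) (hg : i < 2 * g) :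
    dabNum (2 * (b + g + 1)) i (2 * b + 1) =
      ∑ r ∈ Finset.Icc 1 (i / 2), ∑ s ∈ Finset.Icc 1 (i / 2 + 1 - r),
        dyckFirstReturnCount r s * catalan (b + 1 - r) * catalan (g - s) := by
  obtain ⟨F, hF, G, hG, h⟩ := oddSeries_decomposition
  have h1 := congrArg (MvPowerSeries.coeff (expo i b g)) h
  rw [map_add, map_add, coeff_eq_zero_of_mem_highIn hF (by simp; omega),
    coeff_eq_zero_of_mem_highIn hG (by simp; omega),
    coeff_catalanProductSeries_mul i b g (by omega) (by omega), add_zero, add_zero, oddSeries,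
    coeff_expo_seriesOf] at h1
  exact_mod_cast h1

theorem mainTheorem2 :
    (∀ r s : ℕ, 1 ≤ r → 1 ≤ s →
      dyckFirstReturnCount r s =
        ∑ k ∈ Finset.Icc 1 s, catalan (r + s - (k + 1)) * catalan (k - 1)) ∧
    (∀ m i j a b : ℕ, 1 ≤ i → i ≤ j → i + j ≤ 2 * m →
      a = ⌈(i : ℚ) / 2⌉₊ → b = ⌊(j : ℚ) / 2⌋₊ →
      (Odd j →
        dabCount m i j =
          catalan b * catalan (m - b - 1) +
            ∑ r ∈ Finset.Icc 1 (a - 1), ∑ s ∈ Finset.Icc 1 (a - r),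
              dyckFirstReturnCount r s * catalan (b - r + 1) * catalan (m - b - s - 1)) ∧
      (Even j →
        dabCount m i j =
          ∑ r ∈ Finset.Icc 1 (a - 1), ∑ s ∈ Finset.Icc 1 (a - r),
            dyckFirstReturnCount r s * catalan (b - r) * catalan (m - b - s))) := by
  refine ⟨fun r s hr hs ↦ dyckFirstReturnCount_eq_sum hr hs, ?_⟩
  intro m i j a b hi hij hijm ha hb
  obtain ⟨i, rfl⟩ := Nat.exists_eq_add_of_le' hi
  have hb' : b = j / 2 := by
    rw [hb]
    exact_mod_cast Nat.floor_div_eq_div (K := ℚ) j 2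
  have ha' : a = i / 2 + 1 := by
    have h1 : i + 1 = 2 * (i / 2) + 1 ∨ i + 1 = 2 * (i / 2) + 2 := by omega
    rw [ha, Nat.ceil_eq_iff (by omega)]
    rcases h1 with h1 | h1 <;> rw [h1] <;> push_cast <;> constructor <;> linarith
  subst ha'
  constructor
  · rintro ⟨k, rfl⟩
    obtain rfl : b = k := by omega
    obtain ⟨g, rfl⟩ : ∃ g, m = b + g + 1 := ⟨m - b - 1, by omega⟩
    rw [dabCount_eq_dabNum, dabNum_even_eq i b g (by omega) (by omega), Nat.add_sub_cancel]
    rw [show b + g + 1 - b - 1 = g by omega]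
    congr 1
    refine Finset.sum_congr rfl fun r hr ↦ Finset.sum_congr rfl fun s _ ↦ ?_
    rw [Finset.mem_Icc] at hr
    rw [show b - r + 1 = b + 1 - r by omega, show b + g + 1 - b - s - 1 = g - s by omega]
  · rintro ⟨k, rfl⟩
    -- Numbered from `0`, the value is `2 * c + 1` with `c = b - 1`.
    obtain ⟨c, rfl⟩ : ∃ c, k = c + 1 := ⟨k - 1, by omega⟩
    obtain rfl : b = c + 1 := by omega
    obtain ⟨g, rfl⟩ : ∃ g, m = c + g + 1 := ⟨m - c - 1, by omega⟩
    rw [show c + 1 + (c + 1) = 2 * c + 1 + 1 by ring, dabCount_eq_dabNum,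
      dabNum_odd_eq i c g (by omega) (by omega), Nat.add_sub_cancel]
    refine Finset.sum_congr rfl fun r _ ↦ Finset.sum_congr rfl fun s _ ↦ ?_
    rw [show c + g + 1 - (c + 1) - s = g - s by omega]
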